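/- Let $\omega=e^{2\pi i/3}$, let $u_1=\frac{1}{\sqrt6}(2,-1,-1)^T$, and for a root of unity $\eta$ put $$\widetilde T_\eta=\eta\,\mathrm{diag}(1,\omega,\omega^2),\qquad \widetilde S=2u_1u_1^\dagger-\mathbb 1 .$$ (i) Let $\phi_e,\phi_\mu,\phi_\tau\in\mathbb R$ and $\lambda_1,\lambda_2,\lambda_3\in\mathbb C$. The numbers $e^{i\phi_e},e^{i\phi_\mu},e^{i\phi_\tau}$ are three different roots of unity, the $\lambda_j$ are roots of unity, and $$-e^{i\phi_e}+2e^{i\phi_\mu}+2e^{i\phi_\tau}+3\lambda_1+3\lambda_2+3\lambda_3=0,\qquad e^{i\phi_e}e^{i\phi_\mu}e^{i\phi_\tau}=\lambda_1\lambda_2\lambda_3,$$ if and only if, up to exchanging $\phi_\mu$ and $\phi_\tau$ and permuting the $\lambda_j$, $$(e^{i\phi_e},e^{i\phi_\mu},e^{i\phi_\tau})=\eta\,(1,\omega,\omega^2),\qquad(\lambda_1,\lambda_2,\lambda_3)=(\epsilon,-\epsilon,\eta)$$ for some root of unity $\eta$ and $\epsilon=\pm i\eta$. For the remaining parts, call a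 pair $(T,S)$ of unitary $3\times3$ matrices a *residual pair* if $T$ has three different eigenvalues, $S=2uu^\dagger-\mathbb 1$ for some unit vector $u\in\mathbb C^3$, and $T^m=(ST)^n=\mathbb 1$ for some $m,n\ge1$. Say that $(T,S)$ *enforces* TM$_1$ if the following holds for all complex $3\times3$ matrices $M_\ell$ and $\mathcal M_\nu$, $\mathcal M_\nu$ symmetric, with $T^\dagger M_\ell M_\ell^\dagger T=M_\ell M_\ell^\dagger$ and $S^T\mathcal M_\nu S=\mathcal M_\nu$: whenever $U_\ell,U_\nu$ are unitary, $U_\ell^\dagger M_\ell M_\ell^\dagger U_\ell$ is diagonal with entries the squares of three different positive masses, and $U_\nu^T\mathcal M_\nu U_\nu$ is diagonal with three different nonnegative entries, then some column of the mixing matrix $U_\ell^\dagger U_\nu$ equals $u_1$ up to permuting its entries and multiplying them by phases. (The masses may be listed in any order.) (ii) A pair $(T,S)$ of unitary $3\times3$ matrices is a residual pair that enforces TM$_1$ if and only if there are a root of unity $\eta$ and a unitary matrix $V$ such that $V^\dagger TV=\widetilde T_\eta$, $V^\dagger SV=\widetilde S$, the eigenvalues of $ST$ with multiplicity are $i\eta,-i\eta,\eta$,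 and $V^\dagger MM^\dagger V$ is diagonal for every complex $3\times3$ matrix $M$ with $T^\dagger MM^\dagger T=MM^\dagger$. (iii) For every root of unity $\eta$, the matrices $\widetilde T_\eta$ and $\widetilde S$ are unitary and generate a group isomorphic to $\mathbb Z_q\times S_4$, where $q$ is the order of $\eta$. (iv) A group is isomorphic to the group generated by some residual pair $(T,S)$ that enforces TM$_1$ if and only if it is isomorphic to $\mathbb Z_q\times S_4$ for some integer $q\ge1$. -/

import Mathlib

open Matrix Complex

noncomputable section

namespace TM1

/-- Complex `3 × 3` matrices; the indices `0, 1, 2` stand for `e, μ, τ` (rows of the mixing matrix)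
or for the mass eigenstates `1, 2, 3` (columns of the mixing matrix). -/
abbrev Mat3 : Type := Matrix (Fin 3) (Fin 3) ℂ

/-- The group `U(3)` of unitary `3 × 3` matrices. -/
abbrev U3 : Type := Matrix.unitaryGroup (Fin 3) ℂ

/-- `ω = exp(2πi/3)`. -/
def omega : ℂ := Complex.exp (2 * Real.pi * Complex.I / 3)

/-- The first column `u₁ = (2, -1, -1)ᵀ / √6` of TM₁ mixing. -/
def u1 : Fin 3 → ℂ := fun α => ((1 / Real.sqrt 6 : ℝ) : ℂ) * (![2, -1, -1] : Fin 3 → ℂ) α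

/-- The matrix `2 u u† - 1`. -/
def twoProjSubOne (u : Fin 3 → ℂ) : Mat3 := (2 : ℂ) • vecMulVec u (star u) - 1

/-- `T̃ = η diag(1, ω, ω²)`. -/
def Ttilde (η : ℂ) : Mat3 := η • Matrix.diagonal ![1, omega, omega ^ 2]

/-- `S̃ = 2 u₁ u₁† - 1`. -/
def Stilde : Mat3 := twoProjSubOne u1

/-- The system of equations for the phases `x = (e^{iφ_e}, e^{iφ_μ}, e^{iφ_τ})`, three different
roots of unity, and the roots of unity `l = (λ₁, λ₂, λ₃)`: the vanishing sum and the
determinant condition. -/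
structure IsSolution (x l : Fin 3 → ℂ) : Prop where
  rootOfUnity_x : ∀ α, IsOfFinOrder (x α)
  rootOfUnity_l : ∀ j, IsOfFinOrder (l j)
  distinct : Function.Injective x
  vanishing_sum : -x 0 + 2 * x 1 + 2 * x 2 + 3 * l 0 + 3 * l 1 + 3 * l 2 = 0
  det_condition : x 0 * x 1 * x 2 = l 0 * l 1 * l 2

/-- `Uℓ`, `Uν` diagonalize the lepton mass matrices `Mℓ`, `Mν` (the latter symmetric, i.e. a
Majorana mass matrix), with nondegenerate masses: `Uℓ† Mℓ Mℓ† Uℓ = diag(m_e², m_μ², m_τ²)` and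
`Uνᵀ Mν Uν = diag(m₁, m₂, m₃)`. The mixing matrix is then `Uℓ† Uν`. The order in which the masses
are listed is not prescribed. -/
structure Diagonalizes (Mℓ Mν : Mat3) (Uℓ Uν : U3) : Prop where
  majorana : Mν.IsSymm
  charged : ∃ m : Fin 3 → ℝ, (∀ α, 0 < m α) ∧ Function.Injective m ∧
    (Uℓ : Mat3)ᴴ * (Mℓ * Mℓᴴ) * (Uℓ : Mat3) = Matrix.diagonal fun α => ((m α ^ 2 : ℝ) : ℂ)
  neutrino : ∃ m : Fin 3 → ℝ, (∀ j, 0 ≤ m j) ∧ Function.Injective m ∧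
    (Uν : Mat3)ᵀ * Mν * (Uν : Mat3) = Matrix.diagonal fun j => ((m j : ℝ) : ℂ)

/-- `T` leaves `Mℓ Mℓ†` invariant and `S` leaves `Mν` invariant. -/
structure Invariant (T S : U3) (Mℓ Mν : Mat3) : Prop where
  charged : (T : Mat3)ᴴ * (Mℓ * Mℓᴴ) * (T : Mat3) = Mℓ * Mℓᴴ
  neutrino : (S : Mat3)ᵀ * Mν * (S : Mat3) = Mν

/-- A mixing matrix is of TM₁ type, up to the labelling of its rows and columns and up to
rephasing of its rows: one of its columns is `u₁` after a permutation and rephasing of its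
entries. -/
def IsTM1Mixing (U : Mat3) : Prop :=
  ∃ (j : Fin 3) (σ : Equiv.Perm (Fin 3)) (d : Fin 3 → ℂ),
    (∀ α, ‖d α‖ = 1) ∧ ∀ α, U (σ α) j = d α * u1 α

/-- `T` generates the residual symmetry group in the charged-lepton sector and `S` the one in the
neutrino sector: `T` has three different eigenvalues, `S = 2uu† - 1` with a unit vector `u`
(in particular `S² = 1` and `det S = 1`), and `T^m = (ST)^n = 1` for some `m, n ≥ 1`. -/
structure IsResidualPair (T S : U3) : Prop where
  distinct_eigenvalues : (T : Mat3).charpoly.roots.Nodup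
  form_S : ∃ u : Fin 3 → ℂ, star u ⬝ᵥ u = 1 ∧ (S : Mat3) = twoProjSubOne u
  finite_T : IsOfFinOrder T
  finite_ST : IsOfFinOrder (S * T)

/-- The residual symmetries `T`, `S` enforce TM₁: all invariant mass matrices with nondegenerate
masses lead to a mixing matrix of TM₁ type. -/
def EnforcesTM1 (T S : U3) : Prop :=
  ∀ (Mℓ Mν : Mat3) (Uℓ Uν : U3), Invariant T S Mℓ Mν → Diagonalizes Mℓ Mν Uℓ Uν →
    IsTM1Mixing ((Uℓ : Mat3)ᴴ * (Uν : Mat3))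

/-- `G` is (isomorphic to) the group generated by residual symmetries that enforce TM₁. -/
def IsTM1FlavourGroup (G : Type*) [Group G] : Prop :=
  ∃ T S : U3, IsResidualPair T S ∧ EnforcesTM1 T S ∧
    Nonempty (G ≃* Subgroup.closure ({T, S} : Set U3))

/-- The group `ℤ_q × S₄`. -/
abbrev ZqS4 (q : ℕ) : Type := Multiplicative (ZMod q) × Equiv.Perm (Fin 4)

end TM1

end

/-!
All conjugates of a mean of roots of unity lie in the closed unit disc. Modulo `3` the vanishing
sum says that the mean of the phases `x` is an algebraic integer, so by Kronecker's theorem it is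
`0` or a root of unity, and the latter would force the phases to coincide. Hence `x` is
proportional to `(1, ω, ω²)`, and the symmetric functions of the `λ_j` are those of `±iη, η`.

In an eigenbasis of `T` the matrices that commute with `T` are diagonal, and a Majorana mass matrix
is invariant under `2uu† - 1` only if `u` is, up to a phase, a column of `U_ν`. Invariance alone
leaves the other two columns of `U_ν` free; this freedom prevents them from being the source of
`u₁`, so TM₁ is enforced exactly when `u` has the entries of `u₁` up to order and phases. Trace and
determinant of `ST` are then the two equations of the first part.

The generators `diag(1, ω, ω²)` and `2u₁u₁† - 1` are images of permutations under the rotation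
representation of `S₄`, whose only scalar is the identity. Since `T³` and `(ST)⁴` are coprime powers
of the scalar `η`, that scalar lies in the group generated by `T` and `S`, which therefore splits.
-/

namespace TM1

theorem isPrimitiveRoot_omega : IsPrimitiveRoot omega 3 := by
  simpa only [omega, Nat.cast_ofNat] using Complex.isPrimitiveRoot_exp 3 (by norm_num)

theorem omega_pow_three : omega ^ 3 = 1 :=
  isPrimitiveRoot_omega.pow_eq_one

theorem one_add_omega_add_sq : 1 + omega + omega ^ 2 = 0 := by
  simpa [Finset.sum_range_succ] using isPrimitiveRoot_omega.geom_sum_eq_zero (by norm_num)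

theorem isOfFinOrder_omega : IsOfFinOrder omega :=
  isOfFinOrder_iff_pow_eq_one.mpr ⟨3, by norm_num, omega_pow_three⟩

theorem injective_powers_omega : Function.Injective ![1, omega, omega ^ 2] := by
  have hpow : ![1, omega, omega ^ 2] = fun i : Fin 3 => omega ^ (i : ℕ) := by
    ext i; fin_cases i <;> simp
  rw [hpow]
  exact fun i j hij => Fin.ext (isPrimitiveRoot_omega.pow_inj i.isLt j.isLt hij)

theorem star_mul_self_of_norm_eq_one {z : ℂ} (hz : ‖z‖ = 1) : star z * z = 1 := by
  simpa [hz] using Complex.conj_mul' z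

theorem star_omega : star omega = omega ^ 2 := by
  have h := star_mul_self_of_norm_eq_one isOfFinOrder_omega.norm_eq_one
  linear_combination omega ^ 2 * h - star omega * omega_pow_three

theorem eq_of_norm_sum_eq_card {ι E : Type*} [Fintype ι] [NormedAddCommGroup E]
    [NormedSpace ℝ E] [StrictConvexSpace ℝ E] {x : ι → E} (hx : ∀ i, ‖x i‖ = 1)
    (hsum : ‖∑ i, x i‖ = Fintype.card ι) (i j : ι) : x i = x j := by
  classical
  rcases eq_or_ne i j with rfl | hij
  · rfl
  have hrest : ‖∑ k ∈ {i, j}ᶜ, x k‖ ≤ Fintype.card ι - 2 := by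
    have hcard : (({i, j}ᶜ : Finset ι).card : ℝ) = Fintype.card ι - 2 := by
      rw [← Finset.card_add_card_compl {i, j}, Finset.card_pair hij]
      push_cast
      ring
    rw [← hcard]
    simpa only [Finset.sum_const, nsmul_one] using norm_sum_le_of_le _ fun k _ => (hx k).le
  have hpair : 2 ≤ ‖x i + x j‖ := by
    have h := norm_add_le (∑ k ∈ {i, j}, x k) (∑ k ∈ {i, j}ᶜ, x k)
    rw [Finset.sum_add_sum_compl, hsum, Finset.sum_pair hij] at h
    linarith
  refine eq_of_norm_eq_of_norm_add_eq ((hx i).trans (hx j).symm)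
    (le_antisymm (norm_add_le _ _) ?_)
  rw [hx, hx]
  linarith

theorem isIntegral_of_isOfFinOrder {R : Type*} [Ring R] {z : R} (hz : IsOfFinOrder z) :
    IsIntegral ℤ z := by
  obtain ⟨n, hn, h⟩ := isOfFinOrder_iff_pow_eq_one.mp hz
  exact IsIntegral.of_pow hn (h ▸ isIntegral_one)

theorem isOfFinOrder_mean_of_isIntegral {ι K : Type*} [Fintype ι] [Field K] [NumberField K]
    {x : ι → K} (hx : ∀ i, IsOfFinOrder (x i)) (hint : IsIntegral ℤ ((∑ i, x i) / Fintype.card ι))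
    (hne : (∑ i, x i) / Fintype.card ι ≠ 0) : IsOfFinOrder ((∑ i, x i) / Fintype.card ι) := by
  have hle (φ : K →+* ℂ) : ‖φ ((∑ i, x i) / Fintype.card ι)‖ ≤ 1 := by
    have hφ : ∀ i, ‖φ (x i)‖ = 1 := fun i => (φ.toMonoidHom.isOfFinOrder (hx i)).norm_eq_one
    have hsum : ‖∑ i, φ (x i)‖ ≤ Fintype.card ι := by
      simpa [hφ] using norm_sum_le Finset.univ fun i => φ (x i)
    simpa using div_le_one_of_le₀ hsum (Nat.cast_nonneg _)
  obtain ⟨n, hn, h⟩ := NumberField.Embeddings.pow_eq_one_of_norm_le_one K ℂ hne hint hle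
  exact isOfFinOrder_iff_pow_eq_one.mpr ⟨n, hn, h⟩

theorem sum_eq_zero_or_eq_of_isIntegral_mean {ι : Type*} [Fintype ι] {x : ι → ℂ}
    (hx : ∀ i, IsOfFinOrder (x i)) (hint : IsIntegral ℤ ((∑ i, x i) / Fintype.card ι)) :
    ∑ i, x i = 0 ∨ ∀ i j, x i = x j := by
  let K := IntermediateField.adjoin ℚ (Set.range x)
  have : FiniteDimensional ℚ K := IntermediateField.finiteDimensional_adjoin <| by
    rintro _ ⟨i, rfl⟩
    exact (isIntegral_of_isOfFinOrder (hx i)).tower_top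
  have : NumberField K := ⟨⟩
  let y (i : ι) : K := ⟨x i, IntermediateField.subset_adjoin _ _ ⟨i, rfl⟩⟩
  have hy (i : ι) : IsOfFinOrder (y i) :=
    (algebraMap K ℂ).injective.isOfFinOrder_iff.mp (hx i)
  have hmean : algebraMap K ℂ ((∑ i, y i) / Fintype.card ι) = (∑ i, x i) / Fintype.card ι := by
    rw [map_div₀, map_sum, map_natCast]
    rfl
  by_cases hne : (∑ i, x i) / (Fintype.card ι : ℂ) = 0
  · rcases div_eq_zero_iff.mp hne with h | h
    · exact .inl h
    · have := Fintype.card_eq_zero_iff.mp (Nat.cast_eq_zero.mp h)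
      exact .inl (Fintype.sum_empty _)
  · have hfin : IsOfFinOrder (algebraMap K ℂ ((∑ i, y i) / Fintype.card ι)) :=
      (algebraMap K ℂ).toMonoidHom.isOfFinOrder <| isOfFinOrder_mean_of_isIntegral hy
        ((isIntegral_algebraMap_iff (algebraMap K ℂ).injective).mp (hmean ▸ hint))
        ((map_ne_zero _).mp (hmean ▸ hne))
    have hnorm := hfin.norm_eq_one
    rw [hmean, norm_div, Complex.norm_natCast] at hnorm
    exact .inr (eq_of_norm_sum_eq_card (fun i => (hx i).norm_eq_one) (eq_of_div_eq_one hnorm))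

theorem mul_add_mul_add_mul_of_norm_eq_one {a b c : ℂ} (ha : ‖a‖ = 1) (hb : ‖b‖ = 1)
    (hc : ‖c‖ = 1) : a * b + a * c + b * c = a * b * c * star (a + b + c) := by
  rw [star_add, star_add]
  linear_combination -b * c * star_mul_self_of_norm_eq_one ha -
    a * c * star_mul_self_of_norm_eq_one hb - a * b * star_mul_self_of_norm_eq_one hc

theorem eq_mul_omega_of_sum_eq_zero {a b c : ℂ} (ha : ‖a‖ = 1) (hb : ‖b‖ = 1) (hc : ‖c‖ = 1)
    (hsum : a + b + c = 0) :
    (b = a * omega ∧ c = a * omega ^ 2) ∨ (b = a * omega ^ 2 ∧ c = a * omega) := by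
  have hpairs := mul_add_mul_add_mul_of_norm_eq_one ha hb hc
  rw [hsum, star_zero, mul_zero] at hpairs
  have hb' : (b - a * omega) * (b - a * omega ^ 2) = 0 := by
    linear_combination (a + b) * hsum - hpairs - a * b * one_add_omega_add_sq +
      a ^ 2 * omega_pow_three
  rcases mul_eq_zero.mp hb' with h | h
  · exact .inl ⟨by linear_combination h,
      by linear_combination hsum - h - a * one_add_omega_add_sq⟩
  · exact .inr ⟨by linear_combination h,
      by linear_combination hsum - h - a * one_add_omega_add_sq⟩

theorem exists_perm_comp_eq_of_range_subset {ι α : Type*} [Finite ι] {l t : ι → α}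
    (ht : Function.Injective t) (h : Set.range t ⊆ Set.range l) :
    ∃ σ : Equiv.Perm ι, l ∘ σ = t := by
  choose f hf using fun i => h ⟨i, rfl⟩
  have hf_inj : Function.Injective f := fun i j hij => ht (by rw [← hf, ← hf, hij])
  exact ⟨Equiv.ofBijective f hf_inj.bijective_of_finite, funext hf⟩

theorem injective_I_mul {η : ℂ} (hη : η ≠ 0) : Function.Injective ![I * η, -(I * η), η] := by
  have hI : Function.Injective ![I, -I, 1] := by
    intro i j
    fin_cases i <;> fin_cases j <;> norm_num [Complex.ext_iff]
  convert (mul_left_injective₀ hη).comp hI using 1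
  ext i; fin_cases i <;> simp

theorem exists_perm_of_sum_eq_of_prod_eq {l : Fin 3 → ℂ} {η : ℂ} (hl : ∀ j, ‖l j‖ = 1)
    (hη : ‖η‖ = 1) (hsum : l 0 + l 1 + l 2 = η) (hprod : l 0 * l 1 * l 2 = η ^ 3) :
    ∃ σ : Equiv.Perm (Fin 3), l ∘ σ = ![I * η, -(I * η), η] := by
  have hpairs : l 0 * l 1 + l 0 * l 2 + l 1 * l 2 = η ^ 2 := by
    rw [mul_add_mul_add_mul_of_norm_eq_one (hl 0) (hl 1) (hl 2), hsum, hprod]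
    linear_combination η ^ 2 * star_mul_self_of_norm_eq_one hη
  refine exists_perm_comp_eq_of_range_subset
    (injective_I_mul (norm_ne_zero_iff.mp (hη ▸ one_ne_zero))) ?_
  rintro _ ⟨k, rfl⟩
  generalize ht : ![I * η, -(I * η), η] k = t
  have hroot : (t - η) * (t ^ 2 + η ^ 2) = 0 := by
    subst ht
    fin_cases k <;> simp [mul_pow]
  have hfactor : (t - l 0) * (t - l 1) * (t - l 2) = 0 := by
    linear_combination hroot - t ^ 2 * hsum + t * hpairs - hprod
  simp only [mul_eq_zero, sub_eq_zero, or_assoc] at hfactor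
  rcases hfactor with h | h | h
  exacts [⟨0, h.symm⟩, ⟨1, h.symm⟩, ⟨2, h.symm⟩]

theorem IsSolution.sum_eq_zero {x l : Fin 3 → ℂ} (h : IsSolution x l) :
    x 0 + x 1 + x 2 = 0 := by
  have hx i := isIntegral_of_isOfFinOrder (h.rootOfUnity_x i)
  have hl j := isIntegral_of_isOfFinOrder (h.rootOfUnity_l j)
  have hmean : (∑ i, x i) / (Fintype.card (Fin 3) : ℂ) = x 1 + x 2 + (l 0 + l 1 + l 2) := by
    rw [Fin.sum_univ_three, Fintype.card_fin, Nat.cast_ofNat]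
    linear_combination -(1 / 3 : ℂ) * h.vanishing_sum
  have hint : IsIntegral ℤ ((∑ i, x i) / (Fintype.card (Fin 3) : ℂ)) :=
    hmean ▸ ((hx 1).add (hx 2)).add (((hl 0).add (hl 1)).add (hl 2))
  rcases sum_eq_zero_or_eq_of_isIntegral_mean h.rootOfUnity_x hint with hsum | heq
  · rwa [Fin.sum_univ_three] at hsum
  · exact absurd (h.distinct (heq 0 1)) (by decide)

theorem IsSolution.exists_perm {x l : Fin 3 → ℂ} (h : IsSolution x l) :
    ∃ σ : Equiv.Perm (Fin 3), l ∘ σ = ![I * x 0, -(I * x 0), x 0] := by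
  have hnorm i := (h.rootOfUnity_x i).norm_eq_one
  refine exists_perm_of_sum_eq_of_prod_eq (fun j => (h.rootOfUnity_l j).norm_eq_one) (hnorm 0)
    (by linear_combination (1 / 3 : ℂ) * h.vanishing_sum - (2 / 3 : ℂ) * h.sum_eq_zero) ?_
  rw [← h.det_condition]
  rcases eq_mul_omega_of_sum_eq_zero (hnorm 0) (hnorm 1) (hnorm 2) h.sum_eq_zero with
    ⟨h1, h2⟩ | ⟨h1, h2⟩ <;>
  · rw [h1, h2]
    linear_combination x 0 ^ 3 * omega_pow_three

theorem IsSolution.swap {x l : Fin 3 → ℂ} (h : IsSolution x l) :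
    IsSolution (x ∘ Equiv.swap 1 2) l where
  rootOfUnity_x _ := h.rootOfUnity_x _
  rootOfUnity_l := h.rootOfUnity_l
  distinct := h.distinct.comp (Equiv.injective _)
  vanishing_sum := by
    have h0 : Equiv.swap (1 : Fin 3) 2 0 = 0 := by decide
    simp only [Function.comp_apply, h0, Equiv.swap_apply_left, Equiv.swap_apply_right]
    linear_combination h.vanishing_sum
  det_condition := by
    have h0 : Equiv.swap (1 : Fin 3) 2 0 = 0 := by decide
    simp only [Function.comp_apply, h0, Equiv.swap_apply_left, Equiv.swap_apply_right]
    linear_combination h.det_condition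

theorem isSolution_comp_perm_iff {x l : Fin 3 → ℂ} (σ : Equiv.Perm (Fin 3)) :
    IsSolution x (l ∘ σ) ↔ IsSolution x l := by
  have hsum := Equiv.sum_comp σ l
  have hprod := Equiv.prod_comp σ l
  simp only [Fin.sum_univ_three, Fin.prod_univ_three] at hsum hprod
  constructor
  · rintro ⟨hx, hl, hinj, hv, hd⟩
    refine ⟨hx, σ.forall_congr_right.mp hl, hinj, ?_, hd.trans hprod⟩
    simp only [Function.comp_apply] at hv
    linear_combination hv - 3 * hsum
  · rintro ⟨hx, hl, hinj, hv, hd⟩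
    refine ⟨hx, fun j => hl (σ j), hinj, ?_, hd.trans hprod.symm⟩
    simp only [Function.comp_apply]
    linear_combination hv + 3 * hsum

theorem isSolution_of_sq_eq_neg_sq {η ε : ℂ} (hη : IsOfFinOrder η) (hε : ε ^ 2 = -η ^ 2) :
    IsSolution ![η, η * omega, η * omega ^ 2] ![ε, -ε, η] where
  rootOfUnity_x := by
    simpa [Fin.forall_fin_succ, hη] using
      ⟨hη.mul isOfFinOrder_omega, hη.mul isOfFinOrder_omega.pow⟩
  rootOfUnity_l := by
    have hfin (z : ℂ) (hz : z ^ 2 = -η ^ 2) : IsOfFinOrder z := by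
      have h4 : z ^ 4 = η ^ 4 := by linear_combination (z ^ 2 - η ^ 2) * hz
      exact .of_pow (h4 ▸ hη.pow) four_ne_zero
    simpa [Fin.forall_fin_succ, hη] using ⟨hfin ε hε, hfin (-ε) (by rw [neg_sq, hε])⟩
  distinct := by
    have hη0 : η ≠ 0 := fun h => by simpa [h] using hη.norm_eq_one
    convert (mul_right_injective₀ hη0).comp injective_powers_omega using 1
    ext i; fin_cases i <;> simp
  vanishing_sum := by
    simp only [cons_val]
    linear_combination 2 * η * one_add_omega_add_sq
  det_condition := by
    simp only [cons_val]
    linear_combination η ^ 3 * omega_pow_three + η * hε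

theorem isSolution_iff {x l : Fin 3 → ℂ} :
    IsSolution x l ↔
      ∃ η ε : ℂ, IsOfFinOrder η ∧ (ε = I * η ∨ ε = -(I * η)) ∧ x 0 = η ∧
        ((x 1 = η * omega ∧ x 2 = η * omega ^ 2) ∨ (x 1 = η * omega ^ 2 ∧ x 2 = η * omega)) ∧
        ∃ σ : Equiv.Perm (Fin 3), l ∘ σ = ![ε, -ε, η] := by
  constructor
  · intro h
    have hnorm i := (h.rootOfUnity_x i).norm_eq_one
    exact ⟨x 0, I * x 0, h.rootOfUnity_x 0, .inl rfl, rfl,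
      eq_mul_omega_of_sum_eq_zero (hnorm 0) (hnorm 1) (hnorm 2) h.sum_eq_zero, h.exists_perm⟩
  · rintro ⟨η, ε, hη, hε, h0, hx, σ, hl⟩
    have hε2 : ε ^ 2 = -η ^ 2 := by
      rcases hε with rfl | rfl <;> simp [mul_pow]
    have hsol := isSolution_of_sq_eq_neg_sq hη hε2
    rw [← isSolution_comp_perm_iff σ, hl]
    rcases hx with ⟨h1, h2⟩ | ⟨h1, h2⟩
    · convert hsol
      ext i; fin_cases i <;> simpa
    · convert hsol.swap
      ext i; fin_cases i <;> simpa

section CommRing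

variable {n R : Type*} [Fintype n] [DecidableEq n] [CommRing R]

theorem mul_eq_mul_diagonal_iff {A W : Matrix n n R} {x : n → R} :
    A * W = W * diagonal x ↔ ∀ j, A *ᵥ W.col j = x j • W.col j := by
  rw [← Matrix.ext_iff, forall_comm]
  simp only [funext_iff, mul_diagonal, Pi.smul_apply, col_apply, smul_eq_mul, mul_comm (x _)]
  rfl

theorem isDiag_of_commute_diagonal [NoZeroDivisors R] {x : n → R} (hx : Function.Injective x)
    {A : Matrix n n R} (h : Commute (diagonal x) A) : A.IsDiag := by
  intro i j hij
  have hentry := congrFun₂ h.eq i j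
  rw [diagonal_mul, mul_diagonal, mul_comm, ← sub_eq_zero, ← mul_sub] at hentry
  exact (mul_eq_zero.mp hentry).resolve_right (sub_ne_zero.mpr (hx.ne hij))

end CommRing

section StarRing

variable {n R : Type*} [Fintype n] [DecidableEq n] [CommRing R] [StarRing R]

theorem conjTranspose_mul_self (V : unitaryGroup n R) : V.1ᴴ * V.1 = 1 :=
  mem_unitaryGroup_iff'.mp V.2

theorem mul_conjTranspose_self (V : unitaryGroup n R) : V.1 * V.1ᴴ = 1 :=
  mem_unitaryGroup_iff.mp V.2

theorem conjTranspose_mul_cancel_left (V : unitaryGroup n R) (A : Matrix n n R) :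
    V.1ᴴ * (V.1 * A) = A := by
  rw [← mul_assoc, conjTranspose_mul_self, one_mul]

theorem mul_conjTranspose_cancel_left (V : unitaryGroup n R) (A : Matrix n n R) :
    V.1 * (V.1ᴴ * A) = A := by
  rw [← mul_assoc, mul_conjTranspose_self, one_mul]

theorem conj_mul_conj (V : unitaryGroup n R) (A B : Matrix n n R) :
    (V.1ᴴ * A * V.1) * (V.1ᴴ * B * V.1) =
      V.1ᴴ * (A * B) * V.1 := by
  simp only [mul_assoc, mul_conjTranspose_cancel_left]

theorem conj_eq_iff {V : unitaryGroup n R} {A B : Matrix n n R} :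
    V.1ᴴ * A * V.1 = B ↔ A = V * B * V.1ᴴ := by
  constructor
  · rintro rfl
    simp only [mul_assoc, mul_conjTranspose_cancel_left, mul_conjTranspose_self, mul_one]
  · rintro rfl
    simp only [mul_assoc, conjTranspose_mul_cancel_left, conjTranspose_mul_self, mul_one]

theorem conj_inj {V : unitaryGroup n R} {A B : Matrix n n R} :
    V.1ᴴ * A * V.1 = V.1ᴴ * B * V.1 ↔ A = B := by
  rw [conj_eq_iff, ← conj_eq_iff.mp rfl]

theorem charpoly_conj (V : unitaryGroup n R) (A : Matrix n n R) :
    (V.1ᴴ * A * V.1).charpoly = A.charpoly := by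
  rw [Matrix.charpoly_mul_comm, mul_conjTranspose_cancel_left]

theorem conjTranspose_mul_mul_eq_iff_commute {T : unitaryGroup n R} {H : Matrix n n R} :
    T.1ᴴ * H * T.1 = H ↔ Commute T.1 H := by
  rw [conj_eq_iff, commute_iff_eq]
  constructor
  · intro h
    conv_rhs => rw [h, mul_assoc, conjTranspose_mul_self, mul_one]
  · intro h
    rw [h, mul_assoc, mul_conjTranspose_self, mul_one]

theorem commute_conj_iff {V : unitaryGroup n R} {A B : Matrix n n R} :
    Commute (V.1ᴴ * A * V.1) (V.1ᴴ * B * V.1) ↔ Commute A B := by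
  rw [commute_iff_eq, commute_iff_eq, conj_mul_conj, conj_mul_conj, conj_inj]

theorem transpose_mul_mul_eq_iff_conj (U : unitaryGroup n R) {S M : Matrix n n R} :
    Sᵀ * M * S = M ↔
      (U.1ᴴ * S * U.1)ᵀ * (U.1ᵀ * M * U.1) * (U.1ᴴ * S * U.1) = U.1ᵀ * M * U.1 := by
  have hUt (A : Matrix n n R) : U.1ᴴᵀ * (U.1ᵀ * A) = A := by
    rw [← mul_assoc, ← transpose_mul, mul_conjTranspose_self, transpose_one, one_mul]
  have hcong : (U.1ᴴ * S * U.1)ᵀ * (U.1ᵀ * M * U.1) * (U.1ᴴ * S * U.1) =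
      U.1ᵀ * (Sᵀ * M * S) * U.1 := by
    simp only [transpose_mul, mul_assoc, hUt, mul_conjTranspose_cancel_left]
  rw [hcong]
  refine ⟨fun h => by rw [h], fun h => ?_⟩
  simpa only [mul_assoc, hUt, mul_conjTranspose_self, mul_one] using
    congr(U.1ᴴᵀ * $h * U.1ᴴ)

theorem star_mulVec_dotProduct_mulVec (V : unitaryGroup n R) (v w : n → R) :
    star (V.1 *ᵥ v) ⬝ᵥ (V.1 *ᵥ w) = star v ⬝ᵥ w := by
  rw [star_mulVec, ← dotProduct_mulVec, mulVec_mulVec, conjTranspose_mul_self, one_mulVec]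

theorem star_conjTranspose_mulVec_dotProduct_mulVec (V : unitaryGroup n R) (v w : n → R) :
    star (V.1ᴴ *ᵥ v) ⬝ᵥ (V.1ᴴ *ᵥ w) = star v ⬝ᵥ w :=
  star_mulVec_dotProduct_mulVec (star V) v w

theorem isDiag_conj_of_invariant [NoZeroDivisors R] {T V : unitaryGroup n R} {x : n → R}
    (hx : Function.Injective x) (hV : V.1ᴴ * T.1 * V.1 = diagonal x)
    {H : Matrix n n R} (hH : T.1ᴴ * H * T.1 = H) :
    (V.1ᴴ * H * V.1).IsDiag := by
  refine isDiag_of_commute_diagonal hx ?_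
  rw [← hV, commute_conj_iff]
  exact conjTranspose_mul_mul_eq_iff_commute.mp hH

theorem conjTranspose_mul_mul_eq_of_conj_eq_diagonal {T V : unitaryGroup n R} {x y : n → R}
    {H : Matrix n n R} (hT : V.1ᴴ * T.1 * V.1 = diagonal x)
    (hH : V.1ᴴ * H * V.1 = diagonal y) : T.1ᴴ * H * T.1 = H := by
  rw [conjTranspose_mul_mul_eq_iff_commute, ← commute_conj_iff (V := V), hT, hH]
  exact commute_diagonal x y

end StarRing

theorem pow_eq_one_of_mem_spectrum {K A : Type*} [Field K] [Ring A] [Algebra K A] {a : A} {x : K}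
    {k : ℕ} (hx : x ∈ spectrum K a) (ha : a ^ k = 1) : x ^ k = 1 := by
  have : Nontrivial A := not_subsingleton_iff_nontrivial.mp fun _ => by
    simp [spectrum.of_subsingleton] at hx
  simpa only [ha, spectrum.one_eq, Set.mem_singleton_iff] using spectrum.pow_mem_pow a k hx

theorem exists_map_univ_eq {n α : Type*} [Fintype n] {s : Multiset α}
    (hs : s.card = Fintype.card n) : ∃ x : n → α, Finset.univ.val.map x = s := by
  induction s using Quotient.inductionOn with | _ l
  have e : n ≃ Fin l.length := Fintype.equivFinOfCardEq hs.symm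
  refine ⟨l.get ∘ e, ?_⟩
  rw [← Multiset.map_map, Multiset.map_univ_val_equiv, Fin.univ_val_map, List.ofFn_get]
  rfl

section Complex

variable {n : Type*} [Fintype n]

theorem star_dotProduct_self (v : n → ℂ) : star v ⬝ᵥ v = ((∑ i, ‖v i‖ ^ 2 : ℝ) : ℂ) := by
  simp [dotProduct, Complex.conj_mul']

theorem star_dotProduct_self_eq_one_iff {v : n → ℂ} :
    star v ⬝ᵥ v = 1 ↔ ∑ i, ‖v i‖ ^ 2 = 1 := by
  rw [star_dotProduct_self]
  norm_cast

theorem exists_smul_unit {v : n → ℂ} (hv : v ≠ 0) : ∃ c : ℂ, star (c • v) ⬝ᵥ (c • v) = 1 := by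
  have hpos : 0 < ∑ i, ‖v i‖ ^ 2 := by
    obtain ⟨i, hi⟩ := Function.ne_iff.mp hv
    exact Finset.sum_pos' (fun _ _ => sq_nonneg _)
      ⟨i, Finset.mem_univ _, pow_pos (norm_pos_iff.mpr hi) 2⟩
  refine ⟨((√(∑ i, ‖v i‖ ^ 2))⁻¹ : ℝ), ?_⟩
  rw [star_dotProduct_self_eq_one_iff]
  simp only [Pi.smul_apply, smul_eq_mul, norm_mul, mul_pow, Complex.norm_real, norm_inv,
    Real.norm_eq_abs, sq_abs, inv_pow, Real.sq_sqrt hpos.le]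
  rw [← Finset.mul_sum, inv_mul_cancel₀ hpos.ne']

theorem exists_unit_mulVec_eq_zero {m : Type*} [Fintype m] (A : Matrix m n ℂ)
    (hcard : Fintype.card m < Fintype.card n) : ∃ w : n → ℂ, star w ⬝ᵥ w = 1 ∧ A *ᵥ w = 0 := by
  obtain ⟨v, hv, hv0⟩ := A.mulVecLin.ker.exists_mem_ne_zero_of_ne_bot
    (LinearMap.ker_ne_bot_of_finrank_lt (by simpa))
  obtain ⟨c, hc⟩ := exists_smul_unit hv0
  exact ⟨c • v, hc, by rw [mulVec_smul, show A *ᵥ v = 0 from hv, smul_zero]⟩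

variable [DecidableEq n]

theorem sum_norm_sq_row (V : unitaryGroup n ℂ) (i : n) : ∑ j, ‖V.1 i j‖ ^ 2 = 1 := by
  have h := congrFun₂ (mul_conjTranspose_self V) i i
  simp only [mul_apply, conjTranspose_apply, one_apply_eq, RCLike.star_def, Complex.mul_conj'] at h
  exact_mod_cast h

theorem sum_norm_sq_column (V : unitaryGroup n ℂ) (j : n) :
    ∑ i, ‖V.1 i j‖ ^ 2 = 1 := by
  simpa using sum_norm_sq_row (star V) j

theorem exists_unitary_col_eq {s : Set n} {w : n → n → ℂ}
    (hw : ∀ j ∈ s, ∀ k ∈ s, star (w j) ⬝ᵥ w k = if j = k then 1 else 0) :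
    ∃ V : unitaryGroup n ℂ, ∀ j ∈ s, V.1.col j = w j := by
  have horth : Orthonormal ℂ (s.domRestrict fun j => WithLp.toLp 2 (w j)) := by
    rw [orthonormal_iff_ite]
    rintro ⟨j, hj⟩ ⟨k, hk⟩
    rw [EuclideanSpace.inner_eq_star_dotProduct, dotProduct_comm]
    simpa only [Subtype.mk.injEq, Set.domRestrict_apply] using hw j hj k hk
  obtain ⟨b, hb⟩ := horth.exists_orthonormalBasis_extension_of_card_eq (by simp)
  refine ⟨⟨of fun i j => b j i, ?_⟩, fun j hj => ?_⟩
  · rw [mem_unitaryGroup_iff']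
    ext j k
    have hjk := orthonormal_iff_ite.mp b.orthonormal j k
    rw [EuclideanSpace.inner_eq_star_dotProduct, dotProduct_comm] at hjk
    rw [one_apply, ← hjk]
    rfl
  · ext i
    simp [hb j hj]

theorem exists_unit_eigenvector {A : Matrix n n ℂ} {a : ℂ} (ha : a ∈ A.charpoly.roots) :
    ∃ v : n → ℂ, star v ⬝ᵥ v = 1 ∧ A *ᵥ v = a • v := by
  have hroot : A.charpoly.IsRoot a := Polynomial.isRoot_of_mem_roots ha
  rw [Polynomial.IsRoot, eval_charpoly] at hroot
  obtain ⟨v, hv, hAv⟩ := exists_mulVec_eq_zero_iff.mpr hroot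
  obtain ⟨c, hc⟩ := exists_smul_unit hv
  rw [sub_mulVec, sub_eq_zero] at hAv
  refine ⟨c • v, hc, ?_⟩
  rw [mulVec_smul, ← hAv, smul_comm]
  simp [scalar_apply, ← smul_one_eq_diagonal, smul_mulVec]

theorem isOfFinOrder_of_mem_roots_charpoly {A : Matrix n n ℂ} (hA : IsOfFinOrder A) {a : ℂ}
    (ha : a ∈ A.charpoly.roots) : IsOfFinOrder a := by
  obtain ⟨k, hk, h⟩ := isOfFinOrder_iff_pow_eq_one.mp hA
  exact isOfFinOrder_iff_pow_eq_one.mpr ⟨k, hk, pow_eq_one_of_mem_spectrum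
    (mem_spectrum_iff_isRoot_charpoly.mpr (Polynomial.isRoot_of_mem_roots ha)) h⟩

theorem card_roots_charpoly (A : Matrix n n ℂ) : A.charpoly.roots.card = Fintype.card n := by
  rw [← (IsAlgClosed.splits A.charpoly).natDegree_eq_card_roots, charpoly_natDegree_eq_dim]

theorem dotProduct_eq_zero_of_eigenvalue_ne {T : unitaryGroup n ℂ} {v w : n → ℂ} {a b : ℂ}
    (hv : T.1 *ᵥ v = a • v) (hw : T.1 *ᵥ w = b • w)
    (hv1 : star v ⬝ᵥ v = 1) (hab : a ≠ b) : star v ⬝ᵥ w = 0 := by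
  have haa := star_mulVec_dotProduct_mulVec T v v
  have habw := star_mulVec_dotProduct_mulVec T v w
  simp only [hv, hw, star_smul, smul_dotProduct, dotProduct_smul, smul_eq_mul, hv1] at haa habw
  have ha : star a ≠ 0 := fun h => by simp [h] at haa
  have hprod : star a * (a - b) * (star v ⬝ᵥ w) = 0 := by
    linear_combination (star v ⬝ᵥ w) * haa - habw
  exact (mul_eq_zero.mp hprod).resolve_left (mul_ne_zero ha (sub_ne_zero.mpr hab))

theorem exists_unitary_diagonalizing {T : unitaryGroup n ℂ}
    (hT : T.1.charpoly.roots.Nodup) :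
    ∃ (W : unitaryGroup n ℂ) (x : n → ℂ), Function.Injective x ∧
      W.1ᴴ * T.1 * W.1 = diagonal x := by
  obtain ⟨x, hx⟩ := exists_map_univ_eq (card_roots_charpoly T.1)
  have hinj : Function.Injective x := Fintype.nodup_map_univ_iff_injective.mp (hx.symm ▸ hT)
  have hmem i : x i ∈ T.1.charpoly.roots :=
    hx ▸ Multiset.mem_map_of_mem x (Finset.mem_univ i)
  choose w hw1 hw using fun i => exists_unit_eigenvector (hmem i)
  obtain ⟨W, hW⟩ := exists_unitary_col_eq (s := Set.univ) (w := w) fun j _ k _ => by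
    split_ifs with hjk
    · rw [← hjk, hw1]
    · exact dotProduct_eq_zero_of_eigenvalue_ne (hw j) (hw k) (hw1 j) (hinj.ne hjk)
  refine ⟨W, x, hinj, ?_⟩
  have hTW : T.1 * W.1 = W * diagonal x :=
    mul_eq_mul_diagonal_iff.mpr fun j => by rw [hW j trivial, hw]
  rw [mul_assoc, hTW, conjTranspose_mul_cancel_left]

end Complex

section Rephasing

variable {n : Type*}

/-- `r` arises from `v` by permuting the entries and multiplying them by phases. A matrix is of
TM₁ type when one of its columns is a rephasing of `u₁`. -/
def IsRephasing (r v : n → ℂ) : Prop :=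
  ∃ (σ : Equiv.Perm n) (d : n → ℂ), (∀ α, ‖d α‖ = 1) ∧ ∀ α, r (σ α) = d α * v α

theorem isTM1Mixing_iff {U : Mat3} : IsTM1Mixing U ↔ ∃ j, IsRephasing (U.col j) u1 :=
  Iff.rfl

theorem IsRephasing.smul {r v : n → ℂ} (h : IsRephasing r v) {c : ℂ} (hc : ‖c‖ = 1) :
    IsRephasing (c • r) v := by
  obtain ⟨σ, d, hd, hr⟩ := h
  refine ⟨σ, c • d, fun α => ?_, fun α => ?_⟩
  · rw [Pi.smul_apply, norm_smul, hc, hd, one_mul]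
  · rw [Pi.smul_apply, Pi.smul_apply, hr, smul_mul_assoc]

theorem IsRephasing.exists_norm_eq {r v : n → ℂ} (h : IsRephasing r v) :
    ∃ σ : Equiv.Perm n, ∀ α, ‖r (σ α)‖ = ‖v α‖ := by
  obtain ⟨σ, d, hd, hr⟩ := h
  exact ⟨σ, fun α => by rw [hr, norm_mul, hd, one_mul]⟩

variable [Fintype n] [DecidableEq n]

theorem exists_perm_of_diagonal_mul_eq {P : unitaryGroup n ℂ} {d e : n → ℂ}
    (he : Function.Injective e) (h : diagonal d * P.1 = P.1 * diagonal e) :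
    ∃ f : Equiv.Perm n, ∀ i j, j ≠ f i → P.1 i j = 0 := by
  have hde i j (hij : P.1 i j ≠ 0) : d i = e j := by
    have hentry := congrFun₂ h i j
    rw [diagonal_mul, mul_diagonal, mul_comm] at hentry
    exact mul_left_cancel₀ hij hentry
  have hrow i : ∃ j, P.1 i j ≠ 0 := by
    by_contra! hzero
    simpa [hzero] using sum_norm_sq_row P i
  choose f hf using hrow
  have hzero i j (hj : j ≠ f i) : P.1 i j = 0 := by
    by_contra hne
    exact hj (he ((hde i j hne).symm.trans (hde i (f i) (hf i))))
  have hsurj : Function.Surjective f := fun j => by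
    by_contra! hj
    simpa [fun i => hzero i j (hj i).symm] using sum_norm_sq_column P j
  exact ⟨Equiv.ofBijective f hsurj.bijective_of_finite, hzero⟩

theorem isRephasing_conjTranspose_mulVec {P : unitaryGroup n ℂ} {d e : n → ℂ}
    (he : Function.Injective e) (h : diagonal d * P.1 = P.1 * diagonal e) (v : n → ℂ) :
    IsRephasing (P.1ᴴ *ᵥ v) v := by
  obtain ⟨f, hf⟩ := exists_perm_of_diagonal_mul_eq he h
  refine ⟨f, fun α => star (P.1 α (f α)), fun α => ?_, fun α => ?_⟩
  · have hrow := sum_norm_sq_row P α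
    rw [Finset.sum_eq_single (f α) (fun j _ hj => by simp [hf α j hj]) (by simp)] at hrow
    rwa [norm_star, ← pow_eq_one_iff_of_nonneg (norm_nonneg _) two_ne_zero]
  · rw [mulVec, dotProduct, Finset.sum_eq_single α (fun i _ hi => ?_) (by simp),
      conjTranspose_apply]
    rw [conjTranspose_apply, hf i _ (f.injective.ne hi.symm), star_zero, zero_mul]

end Rephasing

theorem norm_sq_u1 (α : Fin 3) : ‖u1 α‖ ^ 2 = ![2 / 3, 1 / 6, 1 / 6] α := by
  fin_cases α <;> norm_num [u1, mul_pow]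

theorem star_u1 : star u1 = u1 := by
  ext α
  fin_cases α <;> simp [u1]

theorem star_u1_dotProduct_u1 : star u1 ⬝ᵥ u1 = 1 := by
  rw [star_dotProduct_self_eq_one_iff, Fin.sum_univ_three]
  simp only [norm_sq_u1, cons_val]
  norm_num

theorem IsRephasing.norm_sq_eq_or {r : Fin 3 → ℂ} (h : IsRephasing r u1) (α : Fin 3) :
    ‖r α‖ ^ 2 = 2 / 3 ∨ ‖r α‖ ^ 2 = 1 / 6 := by
  obtain ⟨σ, hσ⟩ := h.exists_norm_eq
  obtain ⟨β, rfl⟩ := σ.surjective α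
  rw [hσ, norm_sq_u1]
  fin_cases β <;> simp

theorem IsRephasing.exists_norm_sq_eq {r : Fin 3 → ℂ} (h : IsRephasing r u1) :
    ∃ α, ‖r α‖ ^ 2 = 2 / 3 := by
  obtain ⟨σ, hσ⟩ := h.exists_norm_eq
  exact ⟨σ 0, by rw [hσ, norm_sq_u1, cons_val_zero]⟩

theorem fourier_mem_unitaryGroup {n : ℕ} {ζ : ℂ} (hζ : IsPrimitiveRoot ζ n)
    {r : Fin n → ℂ} (hr : ∀ i, ‖r i‖ ^ 2 = 1 / n) :
    (of fun i k : Fin n => r i * ζ ^ (i * k : ℕ)) ∈ unitaryGroup (Fin n) ℂ := by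
  rw [mem_unitaryGroup_iff]
  ext i j
  have hn : n ≠ 0 := i.pos.ne'
  have hζ0 : ζ ≠ 0 := hζ.ne_zero hn
  have hstar : star ζ = ζ⁻¹ := (Complex.inv_eq_conj (hζ.norm'_eq_one hn)).symm
  have hentry : ((of fun i k : Fin n => r i * ζ ^ (i * k : ℕ)) *
      star (of fun i k : Fin n => r i * ζ ^ (i * k : ℕ))) i j =
      r i * star (r j) * ∑ k ∈ Finset.range n, (ζ ^ (i : ℕ) / ζ ^ (j : ℕ)) ^ k := by
    rw [← Fin.sum_univ_eq_sum_range, mul_apply, Finset.mul_sum]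
    refine Finset.sum_congr rfl fun k _ => ?_
    rw [star_apply, of_apply, of_apply, star_mul', star_pow, hstar, pow_mul, pow_mul,
      div_eq_mul_inv, mul_pow, inv_pow, inv_pow]
    ring
  rw [hentry]
  rcases eq_or_ne i j with rfl | hij
  · have hri : r i * star (r i) = 1 / n := by
      rw [Complex.star_def, Complex.mul_conj', ← Complex.ofReal_pow, hr]
      simp
    rw [div_self (pow_ne_zero _ hζ0), hri]
    simp [hn]
  · have hquot : ζ ^ (i : ℕ) / ζ ^ (j : ℕ) - 1 ≠ 0 := fun h => hij <| Fin.ext <|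
      hζ.pow_inj i.2 j.2 ((div_eq_one_iff_eq (pow_ne_zero _ hζ0)).mp (sub_eq_zero.mp h))
    have hgeom := mul_geom_sum (ζ ^ (i : ℕ) / ζ ^ (j : ℕ)) n
    rw [div_pow, pow_right_comm, pow_right_comm ζ _ n, hζ.pow_eq_one, one_pow, one_pow, div_one,
      sub_self] at hgeom
    rw [(mul_eq_zero.mp hgeom).resolve_left hquot, mul_zero, one_apply_ne hij]

theorem norm_sq_eq_of_forall_completion {r : Fin 3 → ℂ} (hr : star r ⬝ᵥ r = 1)
    (h : ∀ Q : U3, Q.1.col 0 = r → IsTM1Mixing Q) (hr' : ¬ IsRephasing r u1) (α : Fin 3) :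
    ‖r α‖ ^ 2 = 1 / 3 ∨ ‖r α‖ ^ 2 = 5 / 6 := by
  obtain ⟨v, hv, hv0⟩ := exists_unit_mulVec_eq_zero (of ![star r, Pi.single α 1]) (by simp)
  have hrv : star r ⬝ᵥ v = 0 := congrFun hv0 0
  have hvα : v α = 0 := by simpa [mulVec] using congrFun hv0 1
  have hvr : star v ⬝ᵥ r = 0 := by rw [star_dotProduct, hrv, star_zero]
  obtain ⟨Q, hQ⟩ := exists_unitary_col_eq (s := {0, 1}) (w := ![r, v, 0]) (by
    simp [hr, hv, hrv, hvr])
  have hQr : Q.1.col 0 = r := hQ 0 (by simp)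
  have hQv : Q.1.col 1 = v := hQ 1 (by simp)
  obtain ⟨j, hj⟩ := isTM1Mixing_iff.mp (h Q hQr)
  have hrow := sum_norm_sq_row Q α
  simp only [Fin.sum_univ_three, ← col_apply, hQr, hQv, hvα, norm_zero] at hrow
  match j with
  | 0 => exact absurd (hQr ▸ hj) hr'
  | 1 =>
    rw [hQv] at hj
    have h1 := hj.norm_sq_eq_or α
    norm_num [hvα] at h1
  | 2 =>
    have h2 := hj.norm_sq_eq_or α
    grind

theorem isRephasing_of_forall_completion {r : Fin 3 → ℂ} (hr : star r ⬝ᵥ r = 1)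
    (h : ∀ Q : U3, Q.1.col 0 = r → IsTM1Mixing Q) : IsRephasing r u1 := by
  by_contra hr'
  have hcases := norm_sq_eq_of_forall_completion hr h hr'
  have hthird i : ‖r i‖ ^ 2 = 1 / (3 : ℕ) := by
    have hsum := star_dotProduct_self_eq_one_iff.mp hr
    rw [Fin.sum_univ_three] at hsum
    have h0 := hcases 0
    have h1 := hcases 1
    have h2 := hcases 2
    match i with
    | 0 | 1 | 2 => grind
  have hQ := fourier_mem_unitaryGroup isPrimitiveRoot_omega hthird
  obtain ⟨j, hj⟩ := isTM1Mixing_iff.mp (h ⟨_, hQ⟩ (by ext i; simp))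
  obtain ⟨α, hα⟩ := hj.exists_norm_sq_eq
  have hmod : ‖r α * omega ^ (α * j : ℕ)‖ ^ 2 = 1 / (3 : ℕ) := by
    rw [norm_mul, norm_pow, isOfFinOrder_omega.norm_eq_one, one_pow, mul_one, hthird]
  have hcontra := hmod.symm.trans hα
  norm_num at hcontra

theorem twoProjSubOne_conj (V : U3) (u : Fin 3 → ℂ) :
    V.1ᴴ * twoProjSubOne u * V.1 = twoProjSubOne (V.1ᴴ *ᵥ u) := by
  rw [twoProjSubOne, twoProjSubOne, mul_sub, sub_mul, mul_one, conjTranspose_mul_self,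
    Matrix.mul_smul, Matrix.smul_mul, mul_vecMulVec, vecMulVec_mul, star_mulVec,
    conjTranspose_conjTranspose]

theorem twoProjSubOne_single_zero :
    twoProjSubOne (Pi.single 0 1) = diagonal ![1, -1, -1] := by
  ext i j
  fin_cases i <;> fin_cases j <;> norm_num [twoProjSubOne, vecMulVec]

theorem isHermitian_twoProjSubOne (u : Fin 3 → ℂ) : (twoProjSubOne u).IsHermitian := by
  simp [IsHermitian, twoProjSubOne, conjTranspose_smul, conjTranspose_vecMulVec]

theorem twoProjSubOne_mul_self {u : Fin 3 → ℂ} (hu : star u ⬝ᵥ u = 1) :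
    twoProjSubOne u * twoProjSubOne u = 1 := by
  rw [twoProjSubOne, sub_mul, mul_sub, Matrix.smul_mul, Matrix.mul_smul, vecMulVec_mul_vecMulVec,
    hu, one_smul, mul_one, one_mul]
  module

theorem eq_twoProjSubOne_of_conj_eq_Stilde {V S : U3} (hS : V.1ᴴ * S.1 * V.1 = Stilde) :
    S.1 = twoProjSubOne (V.1 *ᵥ u1) := by
  rw [conj_eq_iff.mp hS, Stilde]
  simpa [star_eq_conjTranspose] using twoProjSubOne_conj (star V) u1

theorem EnforcesTM1.isTM1Mixing {T S W U : U3} (h : EnforcesTM1 T S) {x s : Fin 3 → ℂ}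
    (hT : W.1ᴴ * T.1 * W.1 = diagonal x) (hS : U.1ᴴ * S.1 * U.1 = diagonal s)
    (hs : ∀ j, s j * s j = 1) : IsTM1Mixing (W.1ᴴ * U.1) := by
  let m : Fin 3 → ℝ := fun j => (j : ℕ) + 1
  have hpos j : 0 < m j := by positivity
  have hinj : Function.Injective m := fun i j hij => by simpa [m, Fin.val_inj] using hij
  let D : Mat3 := diagonal fun j => (m j : ℂ)
  have hcharged : W.1ᴴ * (W.1 * D * (W.1 * D)ᴴ) * W.1 = diagonal fun j => ((m j ^ 2 : ℝ) : ℂ) := by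
    rw [conj_eq_iff]
    have hDD : D * Dᴴ = diagonal fun j => ((m j ^ 2 : ℝ) : ℂ) := by
      simp [D, diagonal_conjTranspose, Pi.star_def, sq]
    rw [conjTranspose_mul, ← hDD]
    simp only [mul_assoc]
  have hneutrino : U.1ᵀ * (U.1ᴴᵀ * D * U.1ᴴ) * U.1 = D := by
    have hUt : U.1ᵀ * U.1ᴴᵀ = 1 := by rw [← transpose_mul, conjTranspose_mul_self, transpose_one]
    rw [mul_assoc, mul_assoc, mul_assoc, conjTranspose_mul_self, mul_one, ← mul_assoc, hUt, one_mul]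
  refine h (W.1 * D) (U.1ᴴᵀ * D * U.1ᴴ) W U
    ⟨conjTranspose_mul_mul_eq_of_conj_eq_diagonal hT hcharged, ?_⟩
    ⟨?_, ⟨m, hpos, hinj, hcharged⟩, ⟨m, fun j => (hpos j).le, hinj, hneutrino⟩⟩
  · rw [transpose_mul_mul_eq_iff_conj U, hS, hneutrino, diagonal_transpose, diagonal_mul_diagonal,
      diagonal_mul_diagonal]
    congr 1
    ext j
    rw [mul_right_comm, hs, one_mul]
  · rw [IsSymm, transpose_mul, transpose_mul, transpose_transpose, diagonal_transpose, mul_assoc]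

theorem EnforcesTM1.isRephasing {T S W : U3} (h : EnforcesTM1 T S) {x u : Fin 3 → ℂ}
    (hW : W.1ᴴ * T.1 * W.1 = diagonal x) (hu : star u ⬝ᵥ u = 1) (hS : S.1 = twoProjSubOne u) :
    IsRephasing (W.1ᴴ *ᵥ u) u1 := by
  refine isRephasing_of_forall_completion
    (by rw [star_conjTranspose_mulVec_dotProduct_mulVec, hu]) fun Q hQ => ?_
  have hcol : (W * Q).1ᴴ *ᵥ u = Pi.single 0 1 := by
    rw [Submonoid.coe_mul, conjTranspose_mul, ← mulVec_mulVec, ← hQ, ← mulVec_single_one,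
      mulVec_mulVec, conjTranspose_mul_self, one_mulVec]
  have hmix := h.isTM1Mixing (U := W * Q) (s := ![1, -1, -1]) hW
    (by rw [hS, twoProjSubOne_conj, hcol, twoProjSubOne_single_zero])
    (fun j => by fin_cases j <;> simp)
  rwa [Submonoid.coe_mul, conjTranspose_mul_cancel_left] at hmix

theorem isDiag_of_transpose_mul_diagonal_mul {n : Type*} [Fintype n] [DecidableEq n]
    {R : Matrix n n ℂ} (hR : R.IsHermitian) (hRR : R * R = 1) {m : n → ℝ} (hm0 : ∀ j, 0 ≤ m j)
    (hm : Function.Injective m)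
    (h : Rᵀ * diagonal (fun j => (m j : ℂ)) * R = diagonal fun j => (m j : ℂ)) : R.IsDiag := by
  have hcomm : Rᵀ * diagonal (fun j => (m j : ℂ)) = diagonal (fun j => (m j : ℂ)) * R := by
    rw [← mul_one (Rᵀ * _), ← hRR, ← mul_assoc, h]
  intro i j hij
  have hentry := congr(‖$(congrFun₂ hcomm i j)‖)
  rw [mul_diagonal, diagonal_mul, transpose_apply, norm_mul, norm_mul, ← hR.apply i j, norm_star,
    Complex.norm_of_nonneg (hm0 i), Complex.norm_of_nonneg (hm0 j), mul_comm] at hentry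
  have hnorm := (mul_eq_mul_right_iff.mp hentry).resolve_left (hm.ne hij.symm)
  rw [← hR.apply i j, norm_eq_zero.mp hnorm, star_zero]

theorem exists_single_eq_smul_of_isDiag {r : Fin 3 → ℂ} (hr : star r ⬝ᵥ r = 1)
    (hdiag : (twoProjSubOne r).IsDiag) :
    ∃ (j : Fin 3) (c : ℂ), ‖c‖ = 1 ∧ Pi.single j 1 = c • r := by
  have hoff i j (hij : i ≠ j) : r i * star (r j) = 0 := by
    simpa [twoProjSubOne, vecMulVec_apply, one_apply_ne hij] using hdiag hij
  obtain ⟨j, hj⟩ : ∃ j, r j ≠ 0 := by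
    by_contra! hzero
    simp [dotProduct, hzero] at hr
  have hzero i (hij : i ≠ j) : r i = 0 :=
    (mul_eq_zero.mp (hoff i j hij)).resolve_right (star_ne_zero.mpr hj)
  have hrj : star (r j) * r j = 1 := by
    rwa [dotProduct, Finset.sum_eq_single j (fun i _ hi => by simp [hzero i hi]) (by simp)] at hr
  refine ⟨j, star (r j), ?_, ?_⟩
  · rw [Complex.star_def, Complex.conj_mul'] at hrj
    rw [norm_star, ← pow_eq_one_iff_of_nonneg (norm_nonneg _) two_ne_zero]
    exact_mod_cast hrj
  · ext i
    rcases eq_or_ne i j with rfl | hij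
    · rw [Pi.single_eq_same, Pi.smul_apply, smul_eq_mul, hrj]
    · rw [Pi.single_eq_of_ne hij, Pi.smul_apply, hzero i hij, smul_zero]

theorem exists_col_eq_smul_of_invariant {S U : U3} {u : Fin 3 → ℂ} (hu : star u ⬝ᵥ u = 1)
    (hS : S.1 = twoProjSubOne u) {M : Mat3} (hM : S.1ᵀ * M * S.1 = M) {m : Fin 3 → ℝ}
    (hm0 : ∀ j, 0 ≤ m j) (hm : Function.Injective m)
    (hU : U.1ᵀ * M * U.1 = diagonal fun j => (m j : ℂ)) :
    ∃ (j : Fin 3) (c : ℂ), ‖c‖ = 1 ∧ U.1.col j = c • u := by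
  have hr : star (U.1ᴴ *ᵥ u) ⬝ᵥ (U.1ᴴ *ᵥ u) = 1 := by
    rw [star_conjTranspose_mulVec_dotProduct_mulVec, hu]
  rw [transpose_mul_mul_eq_iff_conj U, hS, twoProjSubOne_conj, hU] at hM
  obtain ⟨j, c, hc, hsingle⟩ := exists_single_eq_smul_of_isDiag hr
    (isDiag_of_transpose_mul_diagonal_mul (isHermitian_twoProjSubOne _)
      (twoProjSubOne_mul_self hr) hm0 hm hM)
  refine ⟨j, c, hc, ?_⟩
  rw [← mulVec_single_one, hsingle, mulVec_smul, mulVec_mulVec, mul_conjTranspose_self, one_mulVec]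

theorem enforcesTM1_of_conj {T S V : U3} {x : Fin 3 → ℂ} (hx : Function.Injective x)
    (hT : V.1ᴴ * T.1 * V.1 = diagonal x) (hS : V.1ᴴ * S.1 * V.1 = Stilde) : EnforcesTM1 T S := by
  rintro Mℓ Mν Uℓ Uν ⟨hℓ, hν⟩ ⟨-, ⟨m, hm0, hm, hUℓ⟩, ⟨m', hm0', hm', hUν⟩⟩
  have hu : star (V.1 *ᵥ u1) ⬝ᵥ (V.1 *ᵥ u1) = 1 := by
    rw [star_mulVec_dotProduct_mulVec, star_u1_dotProduct_u1]
  obtain ⟨j, c, hc, hcol⟩ := exists_col_eq_smul_of_invariant hu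
    (eq_twoProjSubOne_of_conj_eq_Stilde hS) hν hm0' hm' hUν
  have hinj : Function.Injective fun α => ((m α ^ 2 : ℝ) : ℂ) := fun i k hik =>
    hm ((pow_left_inj₀ (hm0 i).le (hm0 k).le two_ne_zero).mp (Complex.ofReal_injective hik))
  have hdiag := (isDiag_conj_of_invariant hx hT hℓ).diagonal_diag
  have hP : diagonal (V.1ᴴ * (Mℓ * Mℓᴴ) * V.1).diag * (star V * Uℓ).1 =
      (star V * Uℓ).1 * diagonal fun α => ((m α ^ 2 : ℝ) : ℂ) := by
    rw [hdiag, ← hUℓ, Submonoid.coe_mul, Unitary.coe_star, star_eq_conjTranspose]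
    simp only [mul_assoc, mul_conjTranspose_cancel_left]
  refine isTM1Mixing_iff.mpr ⟨j, ?_⟩
  have hmix : (Uℓ.1ᴴ * Uν.1).col j = c • ((star V * Uℓ).1ᴴ *ᵥ u1) := by
    rw [← mulVec_single_one, ← mulVec_mulVec, mulVec_single_one, hcol, mulVec_smul, mulVec_mulVec,
      Submonoid.coe_mul, conjTranspose_mul, Unitary.coe_star, star_eq_conjTranspose,
      conjTranspose_conjTranspose]
  rw [hmix]
  exact (isRephasing_conjTranspose_mulVec hinj hP u1).smul hc

section Eigenbasis

variable {n : Type*} [Fintype n] [DecidableEq n]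

theorem roots_charpoly_of_conj_eq_diagonal {A : Matrix n n ℂ} {V : unitaryGroup n ℂ} {x : n → ℂ}
    (h : V.1ᴴ * A * V.1 = diagonal x) : A.charpoly.roots = Finset.univ.val.map x := by
  have hprod : ∏ i, (Polynomial.X - Polynomial.C (x i)) =
      ((Finset.univ.val.map x).map fun a => Polynomial.X - Polynomial.C a).prod := by
    rw [Multiset.map_map]
    rfl
  rw [← charpoly_conj V, h, charpoly_diagonal, hprod, Polynomial.roots_multiset_prod_X_sub_C]

theorem exists_conj_eq_diagonal_comp {T W : unitaryGroup n ℂ} {x u v d : n → ℂ}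
    {σ : Equiv.Perm n} (hT : W.1ᴴ * T.1 * W.1 = diagonal x) (hd : ∀ α, ‖d α‖ = 1)
    (hu : ∀ α, (W.1ᴴ *ᵥ u) (σ α) = d α * v α) :
    ∃ V : unitaryGroup n ℂ, V.1ᴴ * T.1 * V.1 = diagonal (x ∘ σ) ∧ V.1ᴴ *ᵥ u = v := by
  let Q : Matrix n n ℂ := W.1.submatrix id σ * diagonal d
  have hQstar : Qᴴ = diagonal (star d) * W.1ᴴ.submatrix σ id := by
    simp only [Q, conjTranspose_mul, diagonal_conjTranspose, conjTranspose_submatrix]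
  have hQ {A : Matrix n n ℂ} {y : n → ℂ} (hA : W.1ᴴ * A * W.1 = diagonal y) :
      Qᴴ * A * Q = diagonal (y ∘ σ) := by
    have hsub : W.1ᴴ.submatrix σ id * A * W.1.submatrix id σ = diagonal (y ∘ σ) := by
      rw [← submatrix_diagonal_equiv, ← hA]
      rfl
    simp only [hQstar, Q, ← mul_assoc]
    rw [mul_assoc (diagonal _), mul_assoc (diagonal _), hsub, diagonal_mul_diagonal,
      diagonal_mul_diagonal]
    congr 1
    ext α
    rw [Pi.star_apply, mul_right_comm, star_mul_self_of_norm_eq_one (hd α), one_mul]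
  have hunitary : Q ∈ unitaryGroup n ℂ := by
    have h := hQ (A := 1) (y := 1) (by
      rw [mul_one, conjTranspose_mul_self]
      exact diagonal_one.symm)
    rw [mem_unitaryGroup_iff', star_eq_conjTranspose, ← mul_one Qᴴ, h]
    exact diagonal_one
  refine ⟨⟨Q, hunitary⟩, hQ hT, funext fun α => ?_⟩
  have hentry : (Qᴴ *ᵥ u) α = star (d α) * (W.1ᴴ *ᵥ u) (σ α) := by
    rw [hQstar, ← mulVec_mulVec, mulVec_diagonal]
    rfl
  rw [hentry, hu, ← mul_assoc, star_mul_self_of_norm_eq_one (hd α), one_mul]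

end Eigenbasis

theorem Stilde_eq : Stilde =
    !![1 / 3, -2 / 3, -2 / 3; -2 / 3, -2 / 3, 1 / 3; -2 / 3, 1 / 3, -2 / 3] := by
  have hsqrt : ((1 / √6 : ℝ) : ℂ) * ((1 / √6 : ℝ) : ℂ) = 1 / 6 := by
    rw [← Complex.ofReal_mul, div_mul_div_comm, Real.mul_self_sqrt (by norm_num)]
    norm_num
  have hentry α β : Stilde α β =
      2 * ((1 / √6 : ℝ) * (1 / √6 : ℝ) * (![2, -1, -1] α * ![2, -1, -1] β)) -
        (1 : Mat3) α β := by
    rw [Stilde, twoProjSubOne, star_u1, Matrix.sub_apply, Matrix.smul_apply, vecMulVec_apply,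
      u1, u1, smul_eq_mul]
    ring
  ext α β
  rw [hentry, hsqrt]
  fin_cases α <;> fin_cases β <;> norm_num [one_apply]

theorem det_Stilde : Stilde.det = 1 := by
  rw [Stilde_eq, det_fin_three]
  simp only [of_apply, cons_val]
  norm_num

theorem trace_Stilde_mul_diagonal (x : Fin 3 → ℂ) :
    (Stilde * diagonal x).trace = (x 0 - 2 * x 1 - 2 * x 2) / 3 := by
  rw [trace_fin_three, mul_diagonal, mul_diagonal, mul_diagonal, Stilde_eq]
  simp only [of_apply, cons_val]
  ring

theorem isSolution_of_conj {T S V : U3} {x l : Fin 3 → ℂ} (hx : Function.Injective x)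
    (hTfin : IsOfFinOrder T) (hSTfin : IsOfFinOrder (S * T))
    (hT : V.1ᴴ * T.1 * V.1 = diagonal x) (hS : V.1ᴴ * S.1 * V.1 = Stilde)
    (hl : Finset.univ.val.map l = (S.1 * T.1).charpoly.roots) : IsSolution x l := by
  have hfin {A : U3} (hA : IsOfFinOrder A) {a : ℂ} : a ∈ A.1.charpoly.roots → IsOfFinOrder a :=
    isOfFinOrder_of_mem_roots_charpoly ((unitaryGroup (Fin 3) ℂ).subtype.isOfFinOrder hA)
  have hroots : (Stilde * diagonal x).charpoly.roots = Finset.univ.val.map l := by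
    rw [hl, ← hT, ← hS, conj_mul_conj, charpoly_conj]
  refine ⟨fun α => hfin hTfin ?_, fun j => hfin hSTfin ?_, hx, ?_, ?_⟩
  · rw [roots_charpoly_of_conj_eq_diagonal hT]
    exact Multiset.mem_map_of_mem x (Finset.mem_univ_val α)
  · rw [Submonoid.coe_mul, ← hl]
    exact Multiset.mem_map_of_mem l (Finset.mem_univ_val j)
  · have htrace : (Stilde * diagonal x).trace = ∑ j, l j := by
      rw [trace_eq_sum_roots_charpoly, hroots, Finset.sum_map_val]
    rw [trace_Stilde_mul_diagonal, Fin.sum_univ_three] at htrace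
    linear_combination -3 * htrace
  · have hdet : (Stilde * diagonal x).det = ∏ j, l j := by
      rw [det_eq_prod_roots_charpoly, hroots, Finset.prod_map_val]
    rwa [det_mul, det_Stilde, one_mul, det_diagonal, Fin.prod_univ_three,
      Fin.prod_univ_three] at hdet

theorem Ttilde_eq (η : ℂ) : Ttilde η = diagonal (η • ![1, omega, omega ^ 2]) :=
  (diagonal_smul η _).symm

theorem injective_smul_powers_omega {η : ℂ} (hη : η ≠ 0) :
    Function.Injective (η • ![1, omega, omega ^ 2]) :=
  (smul_right_injective ℂ hη).comp injective_powers_omega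

theorem EnforcesTM1.exists_conj {T S : U3} (hE : EnforcesTM1 T S) (h : IsResidualPair T S) :
    ∃ (V : U3) (x : Fin 3 → ℂ), Function.Injective x ∧ V.1ᴴ * T.1 * V.1 = diagonal x ∧
      V.1ᴴ * S.1 * V.1 = Stilde := by
  obtain ⟨u, hu, hS⟩ := h.form_S
  obtain ⟨W, x, hx, hW⟩ := exists_unitary_diagonalizing h.distinct_eigenvalues
  obtain ⟨σ, d, hd, hWu⟩ := hE.isRephasing hW hu hS
  obtain ⟨V, hV, hVu⟩ := exists_conj_eq_diagonal_comp hW hd hWu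
  exact ⟨V, x ∘ σ, hx.comp σ.injective, hV, by rw [hS, twoProjSubOne_conj, hVu, Stilde]⟩

theorem exists_conj_eq_diagonal_swap {T S V : U3} {x : Fin 3 → ℂ}
    (hT : V.1ᴴ * T.1 * V.1 = diagonal x) (hS : V.1ᴴ * S.1 * V.1 = Stilde) :
    ∃ V' : U3, V'.1ᴴ * T.1 * V'.1 = diagonal (x ∘ Equiv.swap 1 2) ∧
      V'.1ᴴ * S.1 * V'.1 = Stilde := by
  obtain ⟨V', hV', hu⟩ := exists_conj_eq_diagonal_comp (u := V.1 *ᵥ u1) (v := u1) (d := 1)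
    (σ := Equiv.swap 1 2) hT (by simp) (fun α => by
      rw [mulVec_mulVec, conjTranspose_mul_self, one_mulVec]
      fin_cases α <;> simp [u1, Equiv.swap_apply_of_ne_of_ne])
  exact ⟨V', hV', by rw [eq_twoProjSubOne_of_conj_eq_Stilde hS, twoProjSubOne_conj, hu, Stilde]⟩

theorem IsSolution.exists_conj_eq_Ttilde {T S V : U3} {x l : Fin 3 → ℂ} (h : IsSolution x l)
    (hT : V.1ᴴ * T.1 * V.1 = diagonal x) (hS : V.1ᴴ * S.1 * V.1 = Stilde) :
    ∃ V' : U3, V'.1ᴴ * T.1 * V'.1 = Ttilde (x 0) ∧ V'.1ᴴ * S.1 * V'.1 = Stilde := by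
  have hnorm i := (h.rootOfUnity_x i).norm_eq_one
  have hTtilde {y : Fin 3 → ℂ} (h0 : y 0 = x 0) (h1 : y 1 = x 0 * omega)
      (h2 : y 2 = x 0 * omega ^ 2) : diagonal y = Ttilde (x 0) := by
    rw [Ttilde_eq]
    congr 1
    ext i
    fin_cases i <;> simp [h0, h1, h2]
  rcases eq_mul_omega_of_sum_eq_zero (hnorm 0) (hnorm 1) (hnorm 2) h.sum_eq_zero with
    ⟨h1, h2⟩ | ⟨h1, h2⟩
  · exact ⟨V, hT.trans (hTtilde rfl h1 h2), hS⟩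
  · obtain ⟨V', hT', hS'⟩ := exists_conj_eq_diagonal_swap hT hS
    exact ⟨V', hT'.trans (hTtilde rfl h2 h1), hS'⟩

theorem EnforcesTM1.exists_conj_eq_Ttilde {T S : U3} (hE : EnforcesTM1 T S)
    (h : IsResidualPair T S) :
    ∃ (η : ℂ) (V : U3), IsOfFinOrder η ∧ V.1ᴴ * T.1 * V.1 = Ttilde η ∧
      V.1ᴴ * S.1 * V.1 = Stilde ∧
      (S.1 * T.1).charpoly.roots = {I * η, -(I * η), η} ∧
      ∀ M : Mat3, T.1ᴴ * (M * Mᴴ) * T.1 = M * Mᴴ → (V.1ᴴ * (M * Mᴴ) * V.1).IsDiag := by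
  obtain ⟨V, x, hx, hT, hS⟩ := hE.exists_conj h
  obtain ⟨l, hl⟩ := exists_map_univ_eq (card_roots_charpoly (S.1 * T.1))
  have hsol := isSolution_of_conj hx h.finite_T h.finite_ST hT hS hl
  obtain ⟨σ, hσ⟩ := hsol.exists_perm
  obtain ⟨V', hT', hS'⟩ := hsol.exists_conj_eq_Ttilde hT hS
  have hx0 := hsol.rootOfUnity_x 0
  refine ⟨x 0, V', hx0, hT', hS', ?_, fun M => isDiag_conj_of_invariant
    (injective_smul_powers_omega (norm_ne_zero_iff.mp ?_)) (Ttilde_eq (x 0) ▸ hT')⟩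
  · rw [← hl, ← Multiset.map_univ_val_equiv σ, Multiset.map_map, hσ]
    rfl
  · rw [hx0.norm_eq_one]
    exact one_ne_zero

section CentralExtension

variable {G H : Type*} [Group G] [Group H]

theorem mem_of_pow_mem_of_coprime {K : Subgroup H} {ζ : H} {m n : ℕ} (hmn : m.Coprime n)
    (hm : ζ ^ m ∈ K) (hn : ζ ^ n ∈ K) : ζ ∈ K := by
  have hbezout : (ζ ^ m) ^ m.gcdA n * (ζ ^ n) ^ m.gcdB n = ζ := by
    rw [← zpow_natCast, ← zpow_natCast, ← _root_.zpow_mul, ← _root_.zpow_mul, ← _root_.zpow_add,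
      ← Nat.gcd_eq_gcd_ab, hmn.gcd_eq_one, Nat.cast_one, zpow_one]
  exact hbezout ▸ mul_mem (zpow_mem hm _) (zpow_mem hn _)

variable {ρ : G →* H} {ζ : H}

theorem closure_pair_eq_sup (hζ : ∀ g, Commute ζ (ρ g)) {a b : G}
    (hab : Subgroup.closure {a, b} = ⊤) {m n : ℕ} (hmn : m.Coprime n) (ha : a ^ m = 1)
    (hba : (b * a) ^ n = 1) :
    Subgroup.closure {ζ * ρ a, ρ b} = Subgroup.zpowers ζ ⊔ ρ.range := by
  refine le_antisymm ?_ ?_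
  · rw [Subgroup.closure_le, Set.pair_subset_iff]
    exact ⟨Subgroup.mul_mem_sup (Subgroup.mem_zpowers ζ) ⟨a, rfl⟩,
      Subgroup.mem_sup_right ⟨b, rfl⟩⟩
  · obtain ⟨hT, hS⟩ := Set.pair_subset_iff.mp (Subgroup.subset_closure (k := {ζ * ρ a, ρ b}))
    have hζm : (ζ * ρ a) ^ m = ζ ^ m := by
      rw [(hζ a).mul_pow, ← map_pow, ha, map_one, mul_one]
    have hζn : (ρ b * (ζ * ρ a)) ^ n = ζ ^ n := by
      rw [← (hζ b).left_comm, ← map_mul, (hζ _).mul_pow, ← map_pow, hba, map_one, mul_one]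
    have hmem := mem_of_pow_mem_of_coprime hmn (hζm ▸ pow_mem hT m)
      (hζn ▸ pow_mem (mul_mem hS hT) n)
    rw [sup_le_iff, Subgroup.zpowers_le, MonoidHom.range_eq_map, ← hab, MonoidHom.map_closure,
      Set.image_pair, Subgroup.closure_le, Set.pair_subset_iff]
    exact ⟨hmem, (Subgroup.mul_mem_cancel_left _ hmem).mp hT, hS⟩

theorem nonempty_zpowers_sup_range_mulEquiv (hζ : ∀ g, Commute ζ (ρ g))
    (hρ : Function.Injective ρ) (hdisj : Disjoint (Subgroup.zpowers ζ) ρ.range) :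
    Nonempty (↥(Subgroup.zpowers ζ ⊔ ρ.range) ≃* Multiplicative (ZMod (orderOf ζ)) × G) := by
  have hcomm (z : Subgroup.zpowers ζ) (g : G) :
      Commute ((Subgroup.zpowers ζ).subtype z) (ρ g) := by
    obtain ⟨_, k, rfl⟩ := z
    exact (hζ g).zpow_left k
  let Φ := MonoidHom.noncommCoprod (Subgroup.zpowers ζ).subtype ρ hcomm
  have hrange : Φ.range = Subgroup.zpowers ζ ⊔ ρ.range := by
    rw [MonoidHom.noncommCoprod_range, Subgroup.range_subtype]
  have hinj : Function.Injective Φ := by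
    rw [MonoidHom.noncommCoprod_injective, Subgroup.range_subtype]
    exact ⟨Subgroup.subtype_injective _, hρ, hdisj⟩
  have e : Multiplicative (ZMod (orderOf ζ)) ≃* Subgroup.zpowers ζ :=
    Nat.card_zpowers ζ ▸ zmodCyclicMulEquiv inferInstance
  rw [← hrange]
  exact ⟨((e.prodCongr (MulEquiv.refl G)).trans (MonoidHom.ofInjective hinj)).symm⟩

end CentralExtension

section Compression

variable {m n R : Type*} [Fintype m] [Fintype n] [DecidableEq n] [CommRing R]
  {B : Matrix n m R} {C : Matrix m n R}

theorem mul_mul_mul_of_commute (hBC : B * C = 1) {P : Matrix m m R} (hP : Commute P (C * B))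
    (Q : Matrix m m R) : (B * P * C) * (B * Q * C) = B * (P * Q) * C :=
  calc (B * P * C) * (B * Q * C) = B * (P * (C * B)) * Q * C := by simp only [Matrix.mul_assoc]
    _ = (B * C) * (B * P) * Q * C := by rw [hP.eq]; simp only [Matrix.mul_assoc]
    _ = B * (P * Q) * C := by simp only [hBC, Matrix.one_mul, Matrix.mul_assoc]

end Compression

section Permutation

variable {m R : Type*} [Fintype m] [DecidableEq m] [NonAssocSemiring R]

theorem permMatrix_mul_const (σ : Equiv.Perm m) (a : R) :
    σ.permMatrix R * (of fun _ _ => a : Matrix m m R) = of fun _ _ => a :=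
  PEquiv.toMatrix_toPEquiv_mul σ _

theorem const_mul_permMatrix (σ : Equiv.Perm m) (a : R) :
    (of fun _ _ => a : Matrix m m R) * σ.permMatrix R = of fun _ _ => a :=
  PEquiv.mul_toMatrix_toPEquiv _ σ

end Permutation

/-- The vertices of a regular tetrahedron, written as the rows of a matrix in an orthogonal
eigenbasis of the rotation of order three that fixes the last vertex. -/
noncomputable def tetrahedron : Matrix (Fin 4) (Fin 3) ℂ :=
  !![1 / 2, -1, -1; 1 / 2, -omega, -omega ^ 2; 1 / 2, -omega ^ 2, -omega; -3 / 2, 0, 0]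

theorem conjTranspose_tetrahedron : tetrahedronᴴ =
    !![1 / 2, 1 / 2, 1 / 2, -3 / 2; -1, -omega ^ 2, -omega, 0; -1, -omega, -omega ^ 2, 0] := by
  have homega : starRingEnd ℂ omega = omega ^ 2 := star_omega
  have hpow : (omega ^ 2) ^ 2 = omega := by linear_combination omega * omega_pow_three
  ext i k
  fin_cases i <;> fin_cases k <;> simp [tetrahedron, homega, hpow]

theorem conjTranspose_mul_tetrahedron : ((1 / 3 : ℂ) • tetrahedronᴴ) * tetrahedron = 1 := by
  rw [conjTranspose_tetrahedron]
  ext i k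
  fin_cases i <;> fin_cases k <;>
    simp only [tetrahedron, mul_apply, Fin.sum_univ_four, Matrix.smul_apply, one_apply, of_apply,
      cons_val, smul_eq_mul, Fin.zero_eta, Fin.mk_one, Fin.reduceFinMk] <;>
    grind [omega_pow_three, one_add_omega_add_sq]

theorem tetrahedron_mul_conjTranspose :
    tetrahedron * ((1 / 3 : ℂ) • tetrahedronᴴ) = 1 - of fun _ _ => (1 / 4 : ℂ) := by
  rw [conjTranspose_tetrahedron]
  ext i k
  fin_cases i <;> fin_cases k <;>
    simp only [tetrahedron, mul_apply, Fin.sum_univ_three, Matrix.smul_apply, Matrix.sub_apply,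
      one_apply, of_apply, cons_val, smul_eq_mul, Fin.zero_eta, Fin.mk_one, Fin.reduceFinMk] <;>
    grind [omega_pow_three, one_add_omega_add_sq]

theorem permMatrix_mul_tetrahedron (σ : Equiv.Perm (Fin 4)) :
    σ.permMatrix ℂ * (tetrahedron * ((1 / 3 : ℂ) • tetrahedronᴴ)) =
      σ.permMatrix ℂ - of fun _ _ => (1 / 4 : ℂ) := by
  rw [tetrahedron_mul_conjTranspose, Matrix.mul_sub, Matrix.mul_one, permMatrix_mul_const]

theorem commute_permMatrix_tetrahedron (σ : Equiv.Perm (Fin 4)) :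
    Commute (σ.permMatrix ℂ) (tetrahedron * ((1 / 3 : ℂ) • tetrahedronᴴ)) := by
  rw [Commute, SemiconjBy, permMatrix_mul_tetrahedron, tetrahedron_mul_conjTranspose,
    Matrix.sub_mul, Matrix.one_mul, const_mul_permMatrix]

/-- The three-dimensional representation of `S₄` by the rotations of a cube, namely the standard
representation on the span of the vertices of the tetrahedron, twisted by the sign. -/
noncomputable def rotationMatrix : Equiv.Perm (Fin 4) →* Mat3 where
  toFun σ := ((Equiv.Perm.sign σ : ℤ) : ℂ) •
    (((1 / 3 : ℂ) • tetrahedronᴴ) * σ⁻¹.permMatrix ℂ * tetrahedron)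
  map_one' := by
    rw [map_one, inv_one, permMatrix_one, Matrix.mul_one, conjTranspose_mul_tetrahedron,
      Units.val_one, Int.cast_one, one_smul]
  map_mul' σ τ := by
    rw [map_mul, _root_.mul_inv_rev, permMatrix_mul, smul_mul_smul_comm,
      mul_mul_mul_of_commute conjTranspose_mul_tetrahedron (commute_permMatrix_tetrahedron σ⁻¹),
      Units.val_mul, Int.cast_mul]

theorem rotationMatrix_apply (σ : Equiv.Perm (Fin 4)) : rotationMatrix σ =
    ((Equiv.Perm.sign σ : ℤ) : ℂ) •
      (((1 / 3 : ℂ) • tetrahedronᴴ) * σ⁻¹.permMatrix ℂ * tetrahedron) :=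
  rfl

theorem conjTranspose_rotationMatrix (σ : Equiv.Perm (Fin 4)) :
    (rotationMatrix σ)ᴴ = rotationMatrix σ⁻¹ := by
  simp [rotationMatrix_apply, conjTranspose_permMatrix, Matrix.mul_assoc]

/-- The representation of `S₄` by the rotations of a cube as a homomorphism into `U(3)`. -/
noncomputable def rotationHom : Equiv.Perm (Fin 4) →* U3 :=
  rotationMatrix.codRestrict (unitaryGroup (Fin 3) ℂ) fun σ => by
    rw [mem_unitaryGroup_iff', star_eq_conjTranspose, conjTranspose_rotationMatrix, ← map_mul,
      inv_mul_cancel, map_one]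

theorem tetrahedron_mul_rotationMatrix (σ : Equiv.Perm (Fin 4)) :
    tetrahedron * rotationMatrix σ * ((1 / 3 : ℂ) • tetrahedronᴴ) =
      ((Equiv.Perm.sign σ : ℤ) : ℂ) • (σ⁻¹.permMatrix ℂ - of fun _ _ => (1 / 4 : ℂ)) := by
  rw [rotationMatrix_apply, ← permMatrix_mul_tetrahedron]
  generalize hB : (1 / 3 : ℂ) • tetrahedronᴴ = B
  have hBC : B * tetrahedron = 1 := hB ▸ conjTranspose_mul_tetrahedron
  have hcomm : Commute (σ⁻¹.permMatrix ℂ) (tetrahedron * B) := hB ▸ commute_permMatrix_tetrahedron _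
  calc tetrahedron * (((Equiv.Perm.sign σ : ℤ) : ℂ) • (B * σ⁻¹.permMatrix ℂ * tetrahedron)) * B
      = ((Equiv.Perm.sign σ : ℤ) : ℂ) •
          ((tetrahedron * B * σ⁻¹.permMatrix ℂ) * (tetrahedron * B)) := by
        simp only [Matrix.mul_smul, Matrix.smul_mul, Matrix.mul_assoc]
    _ = ((Equiv.Perm.sign σ : ℤ) : ℂ) •
          (σ⁻¹.permMatrix ℂ * (tetrahedron * (B * tetrahedron) * B)) := by
        rw [← hcomm.eq]
        simp only [Matrix.mul_assoc]
    _ = _ := by rw [hBC, Matrix.mul_one]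

theorem eq_one_of_rotationMatrix_eq_smul {σ : Equiv.Perm (Fin 4)} {c : ℂ} (hc : ‖c‖ = 1)
    (h : rotationMatrix σ = c • 1) : σ = 1 := by
  have hlift := tetrahedron_mul_rotationMatrix σ
  rw [h, Matrix.mul_smul (tetrahedron), Matrix.smul_mul c, Matrix.mul_one,
    tetrahedron_mul_conjTranspose] at hlift
  have hsign : ‖((Equiv.Perm.sign σ : ℤ) : ℂ)‖ = 1 := by
    rcases Int.units_eq_one_or (Equiv.Perm.sign σ) with hs | hs <;> simp [hs]
  rw [← inv_eq_one]
  ext1 k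
  by_contra hk
  have hzero : σ⁻¹.permMatrix ℂ k k = 0 := by
    simpa using hk
  have hdiag := congrArg (fun A : Matrix (Fin 4) (Fin 4) ℂ => ‖A k k‖) hlift
  simp only [Matrix.smul_apply, Matrix.sub_apply, of_apply, one_apply_eq, smul_eq_mul, norm_mul,
    hc, hsign, hzero] at hdiag
  norm_num at hdiag

/-- The permutation that `diag(1, ω, ω²)` induces on the vertices of the tetrahedron. -/
def threeCycle : Equiv.Perm (Fin 4) := Equiv.swap 1 2 * Equiv.swap 0 1

theorem rotationMatrix_entry (σ : Equiv.Perm (Fin 4)) (i j : Fin 3) : rotationMatrix σ i j =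
    (Equiv.Perm.sign σ : ℤ) * (1 / 3 * ∑ k, tetrahedronᴴ i k * tetrahedron (σ⁻¹ k) j) := by
  rw [rotationMatrix_apply, Matrix.mul_assoc, PEquiv.toMatrix_toPEquiv_mul, Matrix.smul_mul]
  rfl

theorem rotationMatrix_threeCycle : rotationMatrix threeCycle = Ttilde 1 := by
  have hsign : Equiv.Perm.sign threeCycle = 1 := by decide
  have hperm : ⇑threeCycle⁻¹ = ![1, 2, 0, 3] := by decide
  ext i j
  rw [rotationMatrix_entry, hsign, hperm, conjTranspose_tetrahedron, Ttilde_eq, Fin.sum_univ_four]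
  fin_cases i <;> fin_cases j <;>
    simp only [tetrahedron, diagonal_apply, Pi.smul_apply, of_apply, cons_val, smul_eq_mul,
      Fin.zero_eta, Fin.mk_one, Fin.reduceFinMk, Units.val_one, Int.cast_one] <;>
    grind [omega_pow_three, one_add_omega_add_sq]

theorem rotationMatrix_swap : rotationMatrix (Equiv.swap 0 3) = Stilde := by
  have hsign : Equiv.Perm.sign (Equiv.swap (0 : Fin 4) 3) = -1 := by decide
  have hperm : ⇑(Equiv.swap (0 : Fin 4) 3)⁻¹ = ![3, 1, 2, 0] := by decide
  ext i j
  rw [rotationMatrix_entry, hsign, hperm, conjTranspose_tetrahedron, Stilde_eq, Fin.sum_univ_four]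
  fin_cases i <;> fin_cases j <;>
    simp only [tetrahedron, of_apply, cons_val, Fin.zero_eta, Fin.mk_one, Fin.reduceFinMk,
      Units.val_one, Units.val_neg, Int.cast_one, Int.cast_neg] <;>
    grind [omega_pow_three, one_add_omega_add_sq]

theorem closure_threeCycle_swap : Subgroup.closure {threeCycle, Equiv.swap 0 3} = ⊤ := by
  have hcycle : Equiv.Perm.IsCycle (Equiv.swap 0 3 * threeCycle : Equiv.Perm (Fin 4)) := by
    refine ⟨0, by decide, fun y _ => ?_⟩
    have hpow : ∀ y : Fin 4, ∃ n : Fin 4,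
        ((Equiv.swap 0 3 * threeCycle : Equiv.Perm (Fin 4)) ^ (n : ℕ)) 0 = y := by decide
    obtain ⟨n, hn⟩ := hpow y
    exact ⟨n, hn⟩
  have hadj : (Equiv.swap 0 3 * threeCycle : Equiv.Perm (Fin 4)) 3 = 0 := by decide
  have hclosure := Equiv.Perm.closure_cycle_adjacent_swap hcycle (by decide) 3
  rw [hadj, Equiv.swap_comm 3 0] at hclosure
  obtain ⟨hT, hS⟩ := Set.pair_subset_iff.mp
    (Subgroup.subset_closure (k := {threeCycle, Equiv.swap 0 3}))
  rw [eq_top_iff, ← hclosure, Subgroup.closure_le, Set.pair_subset_iff]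
  exact ⟨mul_mem hS hT, hS⟩

section Scalar

theorem mem_unitary_of_isOfFinOrder {η : ℂ} (hη : IsOfFinOrder η) : η ∈ unitary ℂ :=
  Unitary.mem_iff_star_mul_self.mpr (by simp [Complex.conj_mul', hη.norm_eq_one])

variable {n : Type*} [Fintype n] [DecidableEq n]

/-- The embedding of the complex numbers of modulus one into the unitary group as scalar
matrices. -/
noncomputable def scalarUnitary : unitary ℂ →* unitaryGroup n ℂ where
  toFun c := ⟨(c : ℂ) • 1, Unitary.smul_mem_of_mem c.2 (one_mem _)⟩
  map_one' := Subtype.ext (one_smul ℂ _)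
  map_mul' a b := Subtype.ext <| by
    simp only [Submonoid.coe_mul, smul_mul_smul_comm, mul_one]

theorem coe_scalarUnitary (c : unitary ℂ) :
    (scalarUnitary c : unitaryGroup n ℂ).1 = (c : ℂ) • 1 :=
  rfl

theorem scalarUnitary_injective [Nonempty n] :
    Function.Injective (scalarUnitary : unitary ℂ →* unitaryGroup n ℂ) := fun _ _ hab =>
  Subtype.ext <|
    smul_left_injective ℂ (one_ne_zero : (1 : Matrix n n ℂ) ≠ 0) (congrArg Subtype.val hab)

theorem commute_scalarUnitary (c : unitary ℂ) (A : unitaryGroup n ℂ) :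
    Commute (scalarUnitary c) A :=
  Subtype.ext <| by
    simp only [Submonoid.coe_mul, coe_scalarUnitary, Matrix.smul_mul, Matrix.mul_smul, one_mul,
      mul_one]

end Scalar

section Conjugate

variable {T S V : U3} {η : unitary ℂ}

theorem eq_conj_rotationHom (hS : V.1ᴴ * S.1 * V.1 = Stilde) :
    S = MulAut.conj V (rotationHom (Equiv.swap 0 3)) :=
  Subtype.ext <| by
    rw [conj_eq_iff.mp hS, ← rotationMatrix_swap]
    rfl

theorem smul_rotationMatrix_threeCycle (c : ℂ) :
    (c • (1 : Mat3)) * rotationMatrix threeCycle = Ttilde c := by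
  rw [rotationMatrix_threeCycle, Ttilde, Ttilde, one_smul, Matrix.smul_mul, Matrix.one_mul]

theorem eq_mul_conj_rotationHom (hT : V.1ᴴ * T.1 * V.1 = Ttilde η) :
    T = scalarUnitary η * MulAut.conj V (rotationHom threeCycle) := by
  have hconj : T = V * (scalarUnitary η * rotationHom threeCycle) * V⁻¹ :=
    Subtype.ext <| by
      rw [conj_eq_iff.mp hT, ← smul_rotationMatrix_threeCycle]
      rfl
  rw [hconj, MulAut.conj_apply, ← (commute_scalarUnitary η V).left_comm]
  simp only [mul_assoc]

theorem eq_one_of_conj_rotationHom_eq_scalarUnitary {σ : Equiv.Perm (Fin 4)}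
    (h : MulAut.conj V (rotationHom σ) = scalarUnitary η) : σ = 1 := by
  have hη : ‖(η : ℂ)‖ = 1 := CStarRing.norm_coe_unitary η
  have hconj : MulAut.conj V (rotationHom σ) = MulAut.conj V (scalarUnitary η) := by
    rw [h, MulAut.conj_apply, ← (commute_scalarUnitary η V).eq, mul_inv_cancel_right]
  exact eq_one_of_rotationMatrix_eq_smul hη
    (congrArg Subtype.val ((MulAut.conj V).injective hconj))

theorem nonempty_closure_mulEquiv {η : ℂ} (hη : IsOfFinOrder η)
    (hT : V.1ᴴ * T.1 * V.1 = Ttilde η) (hS : V.1ᴴ * S.1 * V.1 = Stilde) :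
    Nonempty (Subgroup.closure {T, S} ≃* ZqS4 (orderOf η)) := by
  lift η to unitary ℂ using mem_unitary_of_isOfFinOrder hη
  let ρ : Equiv.Perm (Fin 4) →* U3 := (MulAut.conj V).toMonoidHom.comp rotationHom
  have hcomm (σ) : Commute (scalarUnitary η) (ρ σ) := commute_scalarUnitary η _
  have hρ : Function.Injective ρ := (injective_iff_map_eq_one ρ).mpr fun σ hσ =>
    eq_one_of_conj_rotationHom_eq_scalarUnitary (hσ.trans (map_one scalarUnitary).symm)
  have hdisj : Disjoint (Subgroup.zpowers (scalarUnitary η)) ρ.range := by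
    rw [Subgroup.disjoint_def]
    rintro _ ⟨k, rfl⟩ ⟨σ, hσ⟩
    rw [← hσ, eq_one_of_conj_rotationHom_eq_scalarUnitary
      (hσ.trans (map_zpow scalarUnitary η k).symm), map_one]
  have hsup : Subgroup.closure {scalarUnitary η * ρ threeCycle, ρ (Equiv.swap 0 3)} = _ :=
    closure_pair_eq_sup hcomm closure_threeCycle_swap (m := 3) (n := 4)
      (by decide) (by decide) (by decide)
  have horder : orderOf (scalarUnitary η : U3) = orderOf (η : ℂ) := by
    rw [orderOf_injective _ scalarUnitary_injective, orderOf_submonoid]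
  rw [eq_mul_conj_rotationHom hT, eq_conj_rotationHom hS, ← horder]
  exact hsup ▸ nonempty_zpowers_sup_range_mulEquiv hcomm hρ hdisj

theorem isOfFinOrder_of_conj (hη : IsOfFinOrder η) (hT : V.1ᴴ * T.1 * V.1 = Ttilde η)
    (hS : V.1ᴴ * S.1 * V.1 = Stilde) : IsOfFinOrder T ∧ IsOfFinOrder (S * T) := by
  have hfin (σ) : IsOfFinOrder (scalarUnitary η * MulAut.conj V (rotationHom σ)) :=
    (commute_scalarUnitary η _).isOfFinOrder_mul (scalarUnitary.isOfFinOrder hη)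
      (((MulAut.conj V).toMonoidHom.comp rotationHom).isOfFinOrder (isOfFinOrder_of_finite σ))
  rw [eq_mul_conj_rotationHom hT, eq_conj_rotationHom hS,
    ← (commute_scalarUnitary η _).left_comm, ← map_mul, ← map_mul]
  exact ⟨hfin _, hfin _⟩

theorem isResidualPair_and_enforcesTM1_of_conj {η : ℂ} (hη : IsOfFinOrder η)
    (hT : V.1ᴴ * T.1 * V.1 = Ttilde η) (hS : V.1ᴴ * S.1 * V.1 = Stilde) :
    IsResidualPair T S ∧ EnforcesTM1 T S := by
  lift η to unitary ℂ using mem_unitary_of_isOfFinOrder hη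
  obtain ⟨hT_fin, hST_fin⟩ := isOfFinOrder_of_conj (Submonoid.isOfFinOrder_coe.mp hη) hT hS
  have hinj := injective_smul_powers_omega (Unitary.toUnits η).ne_zero
  rw [Ttilde_eq] at hT
  refine ⟨⟨?_, ⟨V.1 *ᵥ u1, ?_, eq_twoProjSubOne_of_conj_eq_Stilde hS⟩, hT_fin, hST_fin⟩,
    enforcesTM1_of_conj hinj hT hS⟩
  · rw [roots_charpoly_of_conj_eq_diagonal hT]
    exact Finset.univ.nodup.map hinj
  · rw [star_mulVec_dotProduct_mulVec, star_u1_dotProduct_u1]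

end Conjugate

theorem exists_unitary_eq_Ttilde (η : unitary ℂ) : ∃ T : U3, T.1 = Ttilde η :=
  ⟨scalarUnitary η * rotationHom threeCycle, smul_rotationMatrix_threeCycle η⟩

theorem exists_unitary_eq_Stilde : ∃ S : U3, S.1 = Stilde :=
  ⟨rotationHom (Equiv.swap 0 3), rotationMatrix_swap⟩

theorem exists_unitary_closure_mulEquiv {η : ℂ} (hη : IsOfFinOrder η) :
    ∃ T S : U3, T.1 = Ttilde η ∧ S.1 = Stilde ∧
      Nonempty (Subgroup.closure {T, S} ≃* ZqS4 (orderOf η)) := by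
  lift η to unitary ℂ using mem_unitary_of_isOfFinOrder hη
  obtain ⟨T, hT⟩ := exists_unitary_eq_Ttilde η
  obtain ⟨S, hS⟩ := exists_unitary_eq_Stilde
  exact ⟨T, S, hT, hS,
    nonempty_closure_mulEquiv (V := 1) hη (by simpa using hT) (by simpa using hS)⟩

theorem isTM1FlavourGroup_iff {G : Type*} [Group G] :
    IsTM1FlavourGroup G ↔ ∃ q : ℕ, 1 ≤ q ∧ Nonempty (G ≃* ZqS4 q) := by
  constructor
  · rintro ⟨T, S, hTS, hE, ⟨e⟩⟩
    obtain ⟨η, V, hη, hT, hS, -⟩ := hE.exists_conj_eq_Ttilde hTS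
    obtain ⟨e'⟩ := nonempty_closure_mulEquiv hη hT hS
    exact ⟨orderOf η, hη.orderOf_pos, ⟨e.trans e'⟩⟩
  · rintro ⟨q, hq, ⟨e⟩⟩
    have hη := Complex.isPrimitiveRoot_exp q (Nat.one_le_iff_ne_zero.mp hq)
    have hη_fin := isOfFinOrder_iff_pow_eq_one.mpr ⟨q, hq, hη.pow_eq_one⟩
    obtain ⟨T, S, hT, hS, ⟨e'⟩⟩ := exists_unitary_closure_mulEquiv hη_fin
    obtain ⟨hTS, hE⟩ := isResidualPair_and_enforcesTM1_of_conj (V := 1) hη_fin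
      (by simpa using hT) (by simpa using hS)
    rw [← hη.eq_orderOf] at e'
    exact ⟨T, S, hTS, hE, ⟨e.trans e'.symm⟩⟩

end TM1

theorem mainTheorem2 :
    -- All solutions of the vanishing sum with the determinant condition.
    (∀ (φ : Fin 3 → ℝ) (l : Fin 3 → ℂ),
      TM1.IsSolution (fun α => Complex.exp (Complex.I * (φ α : ℂ))) l ↔
        ∃ η ε : ℂ, IsOfFinOrder η ∧ (ε = Complex.I * η ∨ ε = -(Complex.I * η)) ∧
          Complex.exp (Complex.I * (φ 0 : ℂ)) = η ∧
          ((Complex.exp (Complex.I * (φ 1 : ℂ)) = η * TM1.omega ∧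
              Complex.exp (Complex.I * (φ 2 : ℂ)) = η * TM1.omega ^ 2) ∨
            (Complex.exp (Complex.I * (φ 1 : ℂ)) = η * TM1.omega ^ 2 ∧
              Complex.exp (Complex.I * (φ 2 : ℂ)) = η * TM1.omega)) ∧
          ∃ σ : Equiv.Perm (Fin 3), l ∘ σ = ![ε, -ε, η]) ∧
    -- The residual generators: up to a change of basis (to the one in which the charged-lepton
    -- mass matrix is diagonal) the pairs that enforce TM₁ are exactly `(T̃, S̃)`.
    (∀ T S : TM1.U3, (TM1.IsResidualPair T S ∧ TM1.EnforcesTM1 T S) ↔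
      ∃ (η : ℂ) (V : TM1.U3), IsOfFinOrder η ∧
        (V : TM1.Mat3)ᴴ * (T : TM1.Mat3) * (V : TM1.Mat3) = TM1.Ttilde η ∧
        (V : TM1.Mat3)ᴴ * (S : TM1.Mat3) * (V : TM1.Mat3) = TM1.Stilde ∧
        ((S : TM1.Mat3) * (T : TM1.Mat3)).charpoly.roots =
          {Complex.I * η, -(Complex.I * η), η} ∧
        ∀ M : TM1.Mat3, (T : TM1.Mat3)ᴴ * (M * Mᴴ) * (T : TM1.Mat3) = M * Mᴴ →
          ((V : TM1.Mat3)ᴴ * (M * Mᴴ) * (V : TM1.Mat3)).IsDiag) ∧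
    -- `T̃` and `S̃` are unitary and generate `ℤ_q × S₄`, with `q` the order of `η`.
    (∀ η : ℂ, IsOfFinOrder η →
      ∃ T S : TM1.U3, (T : TM1.Mat3) = TM1.Ttilde η ∧ (S : TM1.Mat3) = TM1.Stilde ∧
        Nonempty (Subgroup.closure ({T, S} : Set TM1.U3) ≃* TM1.ZqS4 (orderOf η))) ∧
    -- The flavour groups that enforce TM₁ via residual symmetries are exactly the `ℤ_q × S₄`.
    (∀ (G : Type*) [Group G], TM1.IsTM1FlavourGroup G ↔
      ∃ q : ℕ, 1 ≤ q ∧ Nonempty (G ≃* TM1.ZqS4 q)) := by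
  refine ⟨fun φ l => TM1.isSolution_iff, fun T S => ⟨fun h => h.2.exists_conj_eq_Ttilde h.1, ?_⟩,
    fun η => TM1.exists_unitary_closure_mulEquiv, fun G _ => TM1.isTM1FlavourGroup_iff⟩
  rintro ⟨η, V, hη, hT, hS, -⟩
  exact TM1.isResidualPair_and_enforcesTM1_of_conj hη hT hS
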